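/- Let $K$ be a field and let $K_0(\mathcal V_K)$ be the Grothendieck ring of varieties over $K$: the abelian group generated by isomorphism classes $[X]$ of varieties (separated schemes of finite type over $K$) modulo the relations $[X]=[Y]+[X\smallsetminus Y]$ for closed subvarieties $Y\subset X$, with product $[X]\cdot[Y]=[X\times_K Y]$. Let $\mathbb T=[\mathbb A^1\smallsetminus\{0\}]$. For a finite graph $G$ with edge set $E$, let $\Psi_G=\sum_{T}\prod_{e\notin T}t_e$ (sum over the spanning trees $T$ of $G$) be its Kirchhoff–Symanzik polynomial, and let $\mathbb U(G)=[\mathbb A^{E}\smallsetminus\{\Psi_G=0\}]\in K_0(\mathcal V_K)$. Let $\Gamma_0$ be a single edge (with two distinct endpoints), and for $n\ge 1$ let $\Gamma_n$ be the graph obtained from $\Gamma_{n-1}$ by replacing one edge by a string consisting of a single edge, three parallel edges, and a single edge (a $(1,3,1)$-bananification), where the edge replaced is the unique edge of $\Gamma_0$ if $n=1$ and is any one of the three parallel edges created at the previous stage if $n\ge2$. (This is the melonic graph with melonic construction $((1,3,1),0,1),((1,3,1),1,2),\dots,((1,3,1),n-1,2)$, with $n$ interlocked circles and all internal vertices of valence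 $4$.) There are unique polynomials $a_k(r,t)\in\mathbb Z[r,t]$, $k\ge0$, such that $$e^{rs}\cos\big((r^2-rt)^{1/2}s\big)=\sum_{k\ge0}a_k(r,t)\frac{s^k}{k!},$$ and unique polynomials $A_n(t)\in\mathbb Z[t]$, $n\ge0$, such that $\sum_{k\ge0}a_k(r,t)=\sum_{n\ge0}A_n(t)r^n$ as formal power series in $r$. Equivalently, the $A_n(t)$ are the polynomials determined by $$\sum_{n\ge0}A_n(t)r^n=\frac{1-r}{1-(2+t)r+2r^2}.$$ With this notation, for all $n\ge1$, $$\mathbb U(\Gamma_n)=\mathbb T^n(\mathbb T+1)^{2n+1}A_n(\mathbb T)\quad\text{in }K_0(\mathcal V_K).$$ -/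

import Mathlib

open CategoryTheory AlgebraicGeometry MonoidalCategory
open scoped Polynomial

namespace Melonic

universe u

noncomputable section

/-! ## The Grothendieck ring of varieties -/

/-- The property of being a variety over `K`: a separated scheme of finite type over `Spec K`. -/
def isVariety (K : Type u) [Field K] :
    ObjectProperty (Over (Spec (CommRingCat.of K))) := fun X =>
  IsSeparated X.hom ∧ LocallyOfFiniteType X.hom ∧ QuasiCompact X.hom

instance (K : Type u) [Field K] : (isVariety K).IsMonoidal where
  prop_unit := by
    exact ⟨inferInstanceAs (IsSeparated (𝟙 (Spec (CommRingCat.of K)))),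
      inferInstanceAs (LocallyOfFiniteType (𝟙 (Spec (CommRingCat.of K)))),
      inferInstanceAs (QuasiCompact (𝟙 (Spec (CommRingCat.of K))))⟩
  prop_tensor X Y hX hY := by
    obtain ⟨_, _, _⟩ := hX
    obtain ⟨_, _, _⟩ := hY
    refine ⟨?_, ?_, ?_⟩ <;> · rw [Over.tensorObj_hom]; infer_instance

/-- The category of varieties over `K`, with product the fibre product over `Spec K`. -/
abbrev Variety (K : Type u) [Field K] := (isVariety K).FullSubcategory

/-- The commutative monoid of isomorphism classes of varieties over `K`, with multiplication
induced by the product over `K` and unit the class of the point `Spec K`. -/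
abbrev VarietyClass (K : Type u) [Field K] := Skeleton (Variety K)

/-- `IsScissor X Y U`: there is a closed immersion `Y ⟶ X` and an open immersion `U ⟶ X`
over `K`, the image of the latter being the complement of the image of the former; that is,
`Y` is a closed subvariety of `X` and `U` is `X ∖ Y`. -/
def IsScissor {K : Type u} [Field K] (X Y U : Variety K) : Prop :=
  ∃ (i : Y.obj ⟶ X.obj) (j : U.obj ⟶ X.obj),
    IsClosedImmersion i.left ∧ IsOpenImmersion j.left ∧
      Set.range j.left = (Set.range i.left)ᶜ

/-- The isomorphism class of `X`, as a basis element of the free abelian group on isomorphism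
classes, which is a ring under the product of varieties. -/
def freeClass {K : Type u} [Field K] (X : Variety K) : MonoidAlgebra ℤ (VarietyClass K) :=
  MonoidAlgebra.of ℤ (VarietyClass K) (toSkeleton X)

/-- The elements `[X] - [Y] - [X ∖ Y]` of the free abelian group on isomorphism classes. -/
def scissorRelations (K : Type u) [Field K] : Set (MonoidAlgebra ℤ (VarietyClass K)) :=
  {a | ∃ X Y U : Variety K, IsScissor X Y U ∧ a = freeClass X - freeClass Y - freeClass U}

lemma IsScissor.tensor {K : Type u} [Field K] {X Y U : Variety K} (h : IsScissor X Y U)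
    (Z : Variety K) : IsScissor (Z ⊗ X) (Z ⊗ Y) (Z ⊗ U) := by
  obtain ⟨i, j, hi, hj, h⟩ := h
  have key : ∀ {W : Variety K} (f : W.obj ⟶ X.obj),
      IsPullback (Z.obj ◁ f).left (CartesianMonoidalCategory.snd Z.obj W.obj).left
        (CartesianMonoidalCategory.snd Z.obj X.obj).left f.left := by
    intro W f
    have : IsPullback (Z.obj ◁ f) (CartesianMonoidalCategory.snd Z.obj W.obj)
        (CartesianMonoidalCategory.snd Z.obj X.obj) f := by
      refine ⟨⟨by simp⟩, ⟨Limits.PullbackCone.IsLimit.mk _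
        (fun s => CartesianMonoidalCategory.lift
          (s.fst ≫ CartesianMonoidalCategory.fst _ _) s.snd) ?_ ?_ ?_⟩⟩
      · intro s
        have := s.condition
        ext1 <;> simp [this]
      · intro s; simp
      · intro s m h₁ h₂
        ext1
        · simp [← h₁]
        · simpa using h₂
    exact this.map (Over.forget _)
  have hr : ∀ {W : Variety K} (f : W.obj ⟶ X.obj),
      Set.range (Z.obj ◁ f).left =
        (CartesianMonoidalCategory.snd Z.obj X.obj).left ⁻¹' Set.range f.left := by
    intro W f
    have := Scheme.image_preimage_eq_of_isPullback (key f).flip Set.univ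
    simpa using this
  refine ⟨Z.obj ◁ i, Z.obj ◁ j, ?_, ?_, ?_⟩
  · exact MorphismProperty.of_isPullback (P := @IsClosedImmersion) (key i).flip hi
  · exact MorphismProperty.of_isPullback (P := @IsOpenImmersion) (key j).flip hj
  · rw [hr, hr, h, Set.preimage_compl]

/-- The subgroup generated by the scissor relations; it is an ideal. -/
def scissorIdeal (K : Type u) [Field K] : Ideal (MonoidAlgebra ℤ (VarietyClass K)) where
  __ := AddSubgroup.closure (scissorRelations K)
  smul_mem' := by
    intro b x hx
    change x ∈ AddSubgroup.closure (scissorRelations K) at hx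
    change b * x ∈ AddSubgroup.closure (scissorRelations K)
    induction b using MonoidAlgebra.induction_on with
    | of m =>
      induction hx using AddSubgroup.closure_induction with
      | mem x hx =>
        obtain ⟨X, Y, U, h, rfl⟩ := hx
        obtain ⟨Z, rfl⟩ := Quotient.exists_rep m
        refine AddSubgroup.subset_closure ⟨_, _, _, h.tensor Z, ?_⟩
        simp only [freeClass, Skeleton.toSkeleton_tensorObj, map_mul, mul_sub]
      | zero => simp
      | add x y _ _ hx hy => rw [mul_add]; exact add_mem hx hy
      | neg x _ hx => rw [mul_neg]; exact neg_mem hx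
    | add a b ha hb => rw [add_mul]; exact add_mem ha hb
    | smul r a ha => rw [smul_mul_assoc]; exact zsmul_mem ha r

/-- The Grothendieck ring of varieties over `K`: the free abelian group on isomorphism classes of
varieties modulo the relations `[X] = [Y] + [X ∖ Y]`, with product `[X] * [Y] = [X × Y]`. -/
abbrev GrothendieckRing (K : Type u) [Field K] :=
  MonoidAlgebra ℤ (VarietyClass K) ⧸ scissorIdeal K

/-- The class of a variety in the Grothendieck ring. -/
def varietyClass {K : Type u} [Field K] (X : Variety K) : GrothendieckRing K :=
  Ideal.Quotient.mk (scissorIdeal K) (freeClass X)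

/-- The affine variety `Spec A` of a finitely generated `K`-algebra. -/
def affineVariety (K : Type u) [Field K] (A : Type u) [CommRing A] [Algebra K A]
    [Algebra.FiniteType K A] : Variety K where
  obj := Over.mk (Spec.map (CommRingCat.ofHom (algebraMap K A)))
  property := by
    refine ⟨?_, ?_, ?_⟩
    · dsimp; infer_instance
    · exact (HasRingHomProperty.Spec_iff (P := @LocallyOfFiniteType)).mpr
        (RingHom.finiteType_algebraMap.mpr inferInstance)
    · dsimp; infer_instance

/-- The open subset of `Spec A` where `f` does not vanish. -/
def nonvanishingLocus {A : Type u} [CommRing A] (f : A) : (Spec (CommRingCat.of A)).Opens :=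
  PrimeSpectrum.basicOpen (R := A) f

/-- The open complement in `Spec A` of the closed subset where `f` vanishes, as a variety. -/
def hypersurfaceComplement (K : Type u) [Field K] {A : Type u} [CommRing A] [Algebra K A]
    [Algebra.FiniteType K A] (f : A) : Variety K where
  obj := Over.mk ((nonvanishingLocus f).ι ≫
    Spec.map (CommRingCat.ofHom (algebraMap K A)))
  property := by
    have : LocallyOfFiniteType (Spec.map (CommRingCat.ofHom (algebraMap K A))) :=
      (affineVariety K A).property.2.1
    have : IsNoetherianRing A := Algebra.FiniteType.isNoetherianRing K A
    have : IsNoetherianRing (CommRingCat.of A) := this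
    refine ⟨?_, ?_, ?_⟩ <;> · dsimp only [Over.mk_hom]; infer_instance

/-- The class `𝕋` of the torus, i.e. of the complement of the origin in the affine line. -/
def torusClass (K : Type u) [Field K] : GrothendieckRing K :=
  varietyClass (hypersurfaceComplement K (Polynomial.X : K[X]))

/-! ## Graphs and their Kirchhoff polynomials -/

/-- A finite graph, with multiple edges and loops allowed. Edges carry an (auxiliary)
orientation. -/
structure Multigraph where
  /-- the vertices -/
  V : Type
  /-- the edges -/
  E : Type
  [finite_V : Finite V]
  [finite_E : Finite E]
  /-- the initial vertex of an edge -/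
  src : E → V
  /-- the final vertex of an edge -/
  tgt : E → V

attribute [instance] Multigraph.finite_V Multigraph.finite_E

namespace Multigraph

/-- Two vertices are joined by a path (of length `≥ 0`, ignoring orientations) with edges
in `S`. -/
def Joined (G : Multigraph) (S : Set G.E) : G.V → G.V → Prop :=
  Relation.EqvGen fun x y => ∃ e ∈ S, G.src e = x ∧ G.tgt e = y

/-- The edge set `S` is the edge set of a spanning tree: the subgraph with all the vertices and
with edges `S` is connected, and it has no cycles (an edge `e ∈ S` lies on a cycle when its
endpoints are still joined after removing `e`). -/
def IsSpanningTree (G : Multigraph) (S : Set G.E) : Prop :=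
  Nonempty G.V ∧ (∀ x y, G.Joined S x y) ∧ ∀ e ∈ S, ¬ G.Joined (S \ {e}) (G.src e) (G.tgt e)

/-- The Kirchhoff–Symanzik polynomial `∑_T ∏_{e ∉ T} t_e`, the sum over all spanning trees. -/
def kirchhoff (G : Multigraph) (K : Type u) [Field K] : MvPolynomial G.E K :=
  ∑ᶠ S ∈ {S : Set G.E | G.IsSpanningTree S}, ∏ᶠ e ∈ Sᶜ, MvPolynomial.X e

/-- The Grothendieck class `𝕌(G)` of a graph: the class of the complement, in the affine space with
coordinates indexed by the edges, of the locus where the Kirchhoff–Symanzik polynomial vanishes. -/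
def grothendieckClass (G : Multigraph) (K : Type u) [Field K] : GrothendieckRing K :=
  varietyClass (hypersurfaceComplement K (G.kirchhoff K))

/-- The graph with two vertices and a single edge joining them. -/
def singleEdge : Multigraph where
  V := Bool
  E := Unit
  src _ := false
  tgt _ := true

/-- Bananification of an edge `e`: the edge `e` is replaced by a string of `m + 1` bananas, the
`i`-th of which consists of `a i` parallel edges. There are `m` new vertices; the `i`-th banana
goes from the `i`-th to the `(i + 1)`-st vertex in the list consisting of the initial vertex
of `e`, the new vertices, and the final vertex of `e`. -/
def bananify (G : Multigraph) (e : G.E) {m : ℕ} (a : Fin (m + 1) → ℕ) : Multigraph where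
  V := G.V ⊕ Fin m
  E := {x : G.E // x ≠ e} ⊕ (Σ i : Fin (m + 1), Fin (a i))
  src := Sum.elim (fun x => Sum.inl (G.src x))
    fun p => Fin.cases (motive := fun _ => G.V ⊕ Fin m) (Sum.inl (G.src e)) Sum.inr p.1
  tgt := Sum.elim (fun x => Sum.inl (G.tgt x))
    fun p => Fin.lastCases (motive := fun _ => G.V ⊕ Fin m) (Sum.inl (G.tgt e)) Sum.inr p.1

/-- The `(1,3,1)`-bananification of the edge `e`. -/
def bananify131 (G : Multigraph) (e : G.E) : Multigraph :=
  G.bananify e ![1, 3, 1]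

/-- The three parallel edges produced by a `(1,3,1)`-bananification. -/
def middleEdge (G : Multigraph) (e : G.E) (c : Fin 3) : (G.bananify131 e).E :=
  Sum.inr ⟨1, c⟩

end Multigraph

/-- The graph `Γ_n` with one of its edges marked. `Γ_0` is a single edge, and `Γ_{n+1}` is the
`(1,3,1)`-bananification of `Γ_n` at the marked edge; the new marked edge is one of the three
parallel edges just produced, namely the one numbered `c n`. -/
def markedGamma (c : ℕ → Fin 3) : ℕ → Σ G : Multigraph, G.E
  | 0 => ⟨Multigraph.singleEdge, ()⟩
  | n + 1 => ⟨(markedGamma c n).1.bananify131 (markedGamma c n).2,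
      (markedGamma c n).1.middleEdge (markedGamma c n).2 (c n)⟩

/-- The valence-`4` melonic graph `Γ_n` with `n` interlocked circles, with melonic construction
`((1,3,1),0,1), ((1,3,1),1,2), …, ((1,3,1),n-1,2)`, the replaced edge being chosen at each stage
according to `c`. -/
def Gamma (c : ℕ → Fin 3) (n : ℕ) : Multigraph :=
  (markedGamma c n).1

/-! ## The polynomials `A_n` -/

/-- `e^{rs} cos((r² - rt)^{1/2} s) = ∑_k a_k(r,t) s^k / k!`. A bivariate polynomial is a polynomial
in the (outer) variable `r` whose coefficients are polynomials in the (inner) variable `t`.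
Any square root `τ` of `r² - rt` may be used. -/
def IsExpCosExpansion (a : ℕ → ℤ[X][X]) : Prop :=
  ∀ r t τ s : ℂ, τ ^ 2 = r ^ 2 - r * t →
    HasSum (fun k => Polynomial.aevalAeval t r (a k) * s ^ k / (k.factorial : ℂ))
      (Complex.exp (r * s) * Complex.cos (τ * s))

/-- `∑_k a_k(r,t) = ∑_n A_n(t) r^n` as formal power series in `r`: for each `n`, only finitely many
of the `a_k` have a nonzero coefficient of `r^n`, and these coefficients add up to `A_n`. -/
def IsFormalSum (a : ℕ → ℤ[X][X]) (A : ℕ → ℤ[X]) : Prop :=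
  ∀ n, (Function.support fun k => (a k).coeff n).Finite ∧ A n = ∑ᶠ k, (a k).coeff n

/-- `A` is the sequence of polynomials `A_n(t)` defined by the expansion of
`e^{rs} cos((r² - rt)^{1/2} s)`. -/
def IsGammaPolynomials (A : ℕ → ℤ[X]) : Prop :=
  ∃ a : ℕ → ℤ[X][X], IsExpCosExpansion a ∧ IsFormalSum a A

end

end Melonic

/-! For a marked edge `e` write `Ψ_G = t_e A + B`, where `A` collects the spanning trees avoiding
`e` and `B` those containing it. Put `α = [A ≠ 0]` and `β = [A = 0, B ≠ 0]`. Over `A ≠ 0` the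
variable `t_e` avoids a single value, over `A = 0` it is free, so `𝕌(G) = 𝕋 α + (𝕋 + 1) β`
(`locusClass_linear`, `Multigraph.grothendieckClass_eq`). It is enough to follow the pair `(α, β)`.

A spanning tree of the bananification either takes one edge from each of the three bananas (and then
corresponds to a tree containing `e`) or omits exactly one banana (a tree avoiding `e`). With outer
variables `s`, `t` and parallel ones `x`, `y`, `z` this gives `Ψ' = (xy + xz + yz)((s + t)A + B) +
xyzA` (`Multigraph.kirchhoff_bananify131`). It is symmetric in `x`, `y`, `z`, so the choice of the
next marked edge is immaterial; marking `z`, one has `A' = (x + y)((s + t)A + B) + xyA` and `B' =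
xy((s + t)A + B)`. Cutting these loci into pieces yields `α' = 𝕋(𝕋 + 1)³(α + β)` and `β' = 𝕋(𝕋 -
1)(𝕋 + 1)α + 𝕋(𝕋 + 1)²β`, starting from `(0, 1)`. The cuts are checked pointwise over fields,
because a class depends only on the points of a locus (`locusClass_congr`).

With `α = 𝕋ⁿ(𝕋 + 1)²ⁿ⁺¹ p` and `β = 𝕋ⁿ(𝕋 + 1)²ⁿ q`, the pair `(p, q)` evolves by the matrix with
rows `(𝕋 + 1, 1)` and `(𝕋 - 1, 1)`, of trace `𝕋 + 2` and determinant `2`. Hence `𝕋p + q` satisfies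
the recurrence of `A_n(𝕋)`, with the same initial values `1` and `𝕋 + 1`. Nothing is ever divided in
the Grothendieck ring.

On the analytic side, `a_k = (u^k + v^k)/2` with `u, v = r ± iτ`, so `a_{k+2} = 2r a_{k+1} - (2r² -
rt) a_k`. The `r`-adic order of `a_k` is at least `k/2`, and telescoping the partial sums gives the
rational generating function. -/

namespace Melonic

universe u

/-! ### Classes of affine varieties -/

section ClassOfAffine

variable {K : Type u} [Field K]

lemma varietyClass_eq_of_iso {X Y : Variety K} (e : X.obj ≅ Y.obj) :
    varietyClass X = varietyClass Y := by
  have : toSkeleton X = toSkeleton Y :=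
    toSkeleton_eq_toSkeleton_iff.mpr ⟨ObjectProperty.isoMk _ e⟩
  simp only [varietyClass, freeClass, this]

lemma varietyClass_eq_add_of_isScissor {X Y U : Variety K} (h : IsScissor X Y U) :
    varietyClass X = varietyClass Y + varietyClass U := by
  have : freeClass X - freeClass Y - freeClass U ∈ scissorIdeal K :=
    AddSubgroup.subset_closure ⟨X, Y, U, h, rfl⟩
  rw [← sub_eq_zero, ← sub_sub]
  simpa only [varietyClass, map_sub] using Ideal.Quotient.eq_zero_iff_mem.mpr this

lemma varietyClass_tensor (X Y : Variety K) :
    varietyClass (X ⊗ Y) = varietyClass X * varietyClass Y := by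
  simp only [varietyClass, freeClass, Skeleton.toSkeleton_tensorObj, map_mul]

lemma varietyClass_unit : varietyClass (𝟙_ (Variety K)) = 1 := by
  simp only [varietyClass, freeClass, ← Skeleton.one_eq, map_one]

variable (K) in
/-- The class of `Spec A` in the Grothendieck ring. -/
noncomputable def affineClass (A : Type u) [CommRing A] [Algebra K A] [Algebra.FiniteType K A] :
    GrothendieckRing K :=
  varietyClass (affineVariety K A)

variable {A B : Type u} [CommRing A] [Algebra K A] [Algebra.FiniteType K A]
  [CommRing B] [Algebra K B] [Algebra.FiniteType K B]

/-- The morphism over `Spec K` of affine schemes induced by an algebra homomorphism. -/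
noncomputable def specOverMap (φ : A →ₐ[K] B) :
    (affineVariety K B).obj ⟶ (affineVariety K A).obj :=
  Over.homMk (Spec.map (CommRingCat.ofHom φ.toRingHom)) (by
    dsimp [affineVariety]
    rw [← Spec.map_comp, ← CommRingCat.ofHom_comp]
    congr 2
    exact φ.comp_algebraMap)

lemma specOverMap_id : specOverMap (AlgHom.id K A) = 𝟙 _ := by
  ext1
  exact Spec.map_id _

lemma specOverMap_comp {C : Type u} [CommRing C] [Algebra K C] [Algebra.FiniteType K C]
    (φ : A →ₐ[K] B) (ψ : B →ₐ[K] C) :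
    specOverMap (ψ.comp φ) = specOverMap ψ ≫ specOverMap φ := by
  ext1
  exact Spec.map_comp (CommRingCat.ofHom φ.toRingHom) (CommRingCat.ofHom ψ.toRingHom)

lemma affineClass_congr (e : A ≃ₐ[K] B) : affineClass K A = affineClass K B := by
  refine varietyClass_eq_of_iso ⟨specOverMap e.symm.toAlgHom, specOverMap e.toAlgHom, ?_, ?_⟩
  · rw [← specOverMap_comp, ← specOverMap_id]
    congr 1
    ext; simp
  · rw [← specOverMap_comp, ← specOverMap_id]
    congr 1
    ext; simp

lemma affineClass_field : affineClass K K = 1 := by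
  rw [← varietyClass_unit]
  refine varietyClass_eq_of_iso (Over.isoMk (Iso.refl _) ?_)
  simp only [affineVariety, Over.mk_hom]
  change 𝟙 _ ≫ 𝟙 _ = Spec.map (𝟙 _)
  simp

instance : Algebra.FiniteType K (TensorProduct K A B) :=
  .trans (S := A) inferInstance inferInstance

lemma affineClass_tensorProduct :
    affineClass K (TensorProduct K A B) = affineClass K A * affineClass K B := by
  rw [affineClass, affineClass, affineClass, ← varietyClass_tensor]
  refine varietyClass_eq_of_iso (Over.isoMk (pullbackSpecIso K A B).symm ?_)
  change (pullbackSpecIso K A B).inv ≫ (Limits.pullback.fst _ _ ≫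
    Spec.map (CommRingCat.ofHom (algebraMap K A))) = Spec.map _
  rw [pullbackSpecIso_inv_fst_assoc]
  rw [← Spec.map_comp, ← CommRingCat.ofHom_comp]

/-- Additivity of the class: `Spec A` is the union of the closed subset `f = 0` and of its open
complement. -/
lemma affineClass_eq_add (f : A) : affineClass K A =
    affineClass K (A ⧸ Ideal.span {f}) +
      affineClass K (Localization.Away f) := by
  refine varietyClass_eq_add_of_isScissor ⟨specOverMap (Ideal.Quotient.mkₐ K _),
    specOverMap (IsScalarTower.toAlgHom K A _), ?_, ?_, ?_⟩
  · exact IsClosedImmersion.spec_of_surjective _ Ideal.Quotient.mk_surjective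
  · exact IsOpenImmersion.of_isLocalization f
  · change Set.range (PrimeSpectrum.comap (algebraMap A (Localization.Away f))) =
      (Set.range (PrimeSpectrum.comap (Ideal.Quotient.mk (Ideal.span {f}))))ᶜ
    rw [PrimeSpectrum.localization_away_comap_range _ f,
      range_comap_of_surjective _ _ Ideal.Quotient.mk_surjective, Ideal.mk_ker,
      PrimeSpectrum.zeroLocus_span, PrimeSpectrum.basicOpen_eq_zeroLocus_compl]

/-- Cutting along `0` gives `[A] = [A] + [A]`, as both pieces are again the zero ring. -/
lemma affineClass_of_subsingleton [Subsingleton A] : affineClass K A = 0 := by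
  have h := affineClass_eq_add (K := K) (0 : A)
  have : Subsingleton (Localization.Away (0 : A)) :=
    (algebraMap A (Localization.Away (0 : A))).codomain_trivial
  rw [← affineClass_congr (AlgEquiv.ofBijective 
      (IsScalarTower.toAlgHom K A (Localization.Away (0 : A)))
      ⟨fun _ _ _ => Subsingleton.elim _ _, fun x => ⟨0, Subsingleton.elim _ x⟩⟩),
    ← affineClass_congr (AlgEquiv.ofBijective (Ideal.Quotient.mkₐ K (Ideal.span {(0 : A)}))
      ⟨fun _ _ _ => Subsingleton.elim _ _, Ideal.Quotient.mk_surjective⟩)] at h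
  simpa using h

lemma affineClass_polynomial : affineClass K A[X] = affineClass K K[X] * affineClass K A := by
  rw [affineClass_congr (polyEquivTensor K A), affineClass_tensorProduct, mul_comm]

lemma varietyClass_hypersurfaceComplement (f : A) :
    varietyClass (hypersurfaceComplement K f) =
      affineClass K (Localization.Away f) := by
  refine varietyClass_eq_of_iso (Over.isoMk (basicOpenIsoSpecAway (R := .of A) f) ?_)
  dsimp [hypersurfaceComplement, affineVariety]
  have := basicOpenIsoSpecAway_hom_SpecMap (R := .of A) f
  rw [IsScalarTower.algebraMap_eq K A, CommRingCat.ofHom_comp, Spec.map_comp]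
  erw [reassoc_of% this]
  rfl

end ClassOfAffine

/-! ### Locally closed subsets and their points -/

section Locus

variable {R : Type u} [CommRing R]

/-- The coordinate ring of the locally closed subset of `Spec R` where the elements of `Z` vanish
and `f` does not. -/
abbrev LocusRing (Z : Set R) (f : R) : Type u :=
  Localization.Away (Ideal.Quotient.mk (Ideal.span Z) f)

/-- A ring homomorphism which kills `Z` and does not kill `f`: a point of the locus `Z = 0`,
`f ≠ 0` when the target is a field. -/
def IsPointOf {F : Type*} [CommRing F] (Z : Set R) (f : R) (φ : R →+* F) : Prop :=
  (∀ z ∈ Z, φ z = 0) ∧ φ f ≠ 0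

variable {K : Type u} [Field K] [Algebra K R]

namespace LocusRing

variable (K) in
/-- The structure map of the coordinate ring of a locally closed subset. -/
noncomputable def of (Z : Set R) (f : R) : R →ₐ[K] LocusRing Z f :=
  (IsScalarTower.toAlgHom K (R ⧸ Ideal.span Z) (LocusRing Z f)).comp (Ideal.Quotient.mkₐ K _)

lemma of_eq_zero {Z : Set R} (f : R) {z : R} (hz : z ∈ Z) : of K Z f z = 0 := by
  have : Ideal.Quotient.mk (Ideal.span Z) z = 0 :=
    Ideal.Quotient.eq_zero_iff_mem.mpr (Ideal.subset_span hz)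
  simp [of, this]

lemma isUnit_of (Z : Set R) (f : R) : IsUnit (of K Z f f) :=
  IsLocalization.Away.algebraMap_isUnit (Ideal.Quotient.mk (Ideal.span Z) f)

variable {T : Type*} [CommRing T] [Algebra K T]

/-- The universal property of the coordinate ring of a locally closed subset. -/
noncomputable def lift {Z : Set R} {f : R} (φ : R →ₐ[K] T) (hZ : ∀ z ∈ Z, φ z = 0)
    (hf : IsUnit (φ f)) : LocusRing Z f →ₐ[K] T :=
  IsLocalization.liftAlgHom (M := .powers (Ideal.Quotient.mk (Ideal.span Z) f))
    (f := Ideal.Quotient.liftₐ (Ideal.span Z) φ fun _ ha =>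
      (Ideal.span_le (I := RingHom.ker φ)).mpr hZ ha) (by
    rintro ⟨_, n, rfl⟩
    rw [map_pow]
    exact hf.pow n)

@[simp]
lemma lift_of {Z : Set R} {f : R} (φ : R →ₐ[K] T) (hZ : ∀ z ∈ Z, φ z = 0)
    (hf : IsUnit (φ f)) (x : R) : lift φ hZ hf (of K Z f x) = φ x := by
  simp only [lift, of, AlgHom.comp_apply, IsScalarTower.coe_toAlgHom', Ideal.Quotient.mkₐ_eq_mk,
    IsLocalization.liftAlgHom_apply, IsLocalization.lift_eq]
  rfl

lemma lift_comp_of {Z : Set R} {f : R} (φ : R →ₐ[K] T) (hZ : ∀ z ∈ Z, φ z = 0)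
    (hf : IsUnit (φ f)) : (lift φ hZ hf).comp (of K Z f) = φ :=
  AlgHom.ext fun x => by simp

lemma algHom_ext {Z : Set R} {f : R} {φ ψ : LocusRing Z f →ₐ[K] T}
    (h : φ.comp (of K Z f) = ψ.comp (of K Z f)) : φ = ψ := by
  refine IsLocalization.algHom_ext (.powers (Ideal.Quotient.mk (Ideal.span Z) f)) ?_
  refine Ideal.Quotient.algHom_ext _ ?_
  exact h

/-- Locally closed subsets whose coordinate maps satisfy each other's defining conditions have
isomorphic coordinate rings. -/
noncomputable def equivOfUniversal {Z : Set R} {f : R} (φ : R →ₐ[K] T) (hZ : ∀ z ∈ Z, φ z = 0)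
    (hf : IsUnit (φ f)) (ψ : T →ₐ[K] LocusRing Z f) (h₁ : ψ.comp φ = of K Z f)
    (h₂ : (lift φ hZ hf).comp ψ = AlgHom.id K T) : LocusRing Z f ≃ₐ[K] T :=
  AlgEquiv.ofAlgHom (lift φ hZ hf) ψ h₂
    (algHom_ext (by rw [AlgHom.comp_assoc, lift_comp_of, h₁, AlgHom.id_comp]))

/-- A nonunit lies in a maximal ideal, whose residue field is a point of the locus where `a`
vanishes. This turns pointwise information into algebra. -/
lemma isUnit_of_ne_zero {Z : Set R} {f a : R}
    (h : ∀ (F : Type u) [Field F] (φ : R →+* F), IsPointOf Z f φ → φ a ≠ 0) :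
    IsUnit (of K Z f a) := by
  by_contra hn
  obtain ⟨m, hm, ham⟩ := exists_max_ideal_of_mem_nonunits hn
  let := Ideal.Quotient.field m
  refine h (LocusRing Z f ⧸ m) ((Ideal.Quotient.mk m).comp (of K Z f).toRingHom) ⟨?_, ?_⟩
    (Ideal.Quotient.eq_zero_iff_mem.mpr ham)
  · intro z hz
    have := of_eq_zero (K := K) f hz
    change Ideal.Quotient.mk m (of K Z f z) = 0
    rw [this, map_zero]
  · exact ((isUnit_of (K := K) Z f).map (Ideal.Quotient.mk m)).ne_zero

lemma subsingleton (K : Type u) [Field K] [Algebra K R] {Z : Set R} {f : R}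
    (h : ∀ (F : Type u) [Field F] (φ : R →+* F), ¬ IsPointOf Z f φ) :
    Subsingleton (LocusRing Z f) := by
  have := isUnit_of_ne_zero (K := K) (a := 0) fun F _ φ hφ => (h F φ hφ).elim
  rw [map_zero, isUnit_zero_iff] at this
  exact subsingleton_of_zero_eq_one this

end LocusRing

variable [Algebra.FiniteType K R]

variable (K) in
/-- The class of the locally closed subset of `Spec R` where the elements of `Z` vanish and `f`
does not. -/
noncomputable def locusClass (Z : Set R) (f : R) : GrothendieckRing K :=
  affineClass K (LocusRing Z f)

lemma locusClass_eq_zero {Z : Set R} {f : R}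
    (h : ∀ (F : Type u) [Field F] (φ : R →+* F), ¬ IsPointOf Z f φ) :
    locusClass K Z f = 0 :=
  have := LocusRing.subsingleton K h
  affineClass_of_subsingleton

namespace LocusRing

variable (K) in
/-- The closed subset `g = 0` of a locally closed subset. -/
noncomputable def equivQuotient (g : R) (Z : Set R) (f : R) :
    LocusRing (insert g Z) f ≃ₐ[K] LocusRing Z f ⧸ Ideal.span {of K Z f g} :=
  have hZ : ∀ z ∈ Z, of K (insert g Z) f z = 0 := fun _ hz =>
    of_eq_zero f (Set.mem_insert_of_mem _ hz)
  have hker : ∀ a ∈ Ideal.span {of K Z f g},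
      lift (of K (insert g Z) f) hZ (isUnit_of _ f) a = 0 := fun _ ha =>
    (Ideal.span_le (I := RingHom.ker (lift (of K (insert g Z) f) hZ (isUnit_of _ f)))).mpr
      (by rintro _ rfl; simp [of_eq_zero (K := K) f (Set.mem_insert g Z)]) ha
  have hq : ∀ z ∈ insert g Z,
      ((Ideal.Quotient.mkₐ K (Ideal.span {of K Z f g})).comp (of K Z f)) z = 0 := by
    intro z hz
    rcases Set.mem_insert_iff.mp hz with rfl | hz
    · exact Ideal.Quotient.eq_zero_iff_mem.mpr (Ideal.subset_span rfl)
    · simp [of_eq_zero (K := K) f hz]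
  have hf : IsUnit (((Ideal.Quotient.mkₐ K (Ideal.span {of K Z f g})).comp (of K Z f)) f) :=
    (isUnit_of (K := K) Z f).map (Ideal.Quotient.mkₐ K _)
  equivOfUniversal ((Ideal.Quotient.mkₐ K _).comp (of K Z f)) hq hf
    (Ideal.Quotient.liftₐ _ (lift (of K (insert g Z) f) hZ (isUnit_of _ f)) hker)
    (by rw [← AlgHom.comp_assoc, Ideal.Quotient.liftₐ_comp, lift_comp_of])
    (Ideal.Quotient.algHom_ext _ (algHom_ext (by
      rw [AlgHom.comp_assoc _ _ (Ideal.Quotient.mkₐ K _), Ideal.Quotient.liftₐ_comp, AlgHom.comp_assoc,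
        lift_comp_of, lift_comp_of, AlgHom.id_comp])))

lemma liftAlgHom_comp_toAlgHom {A B : Type*} [CommRing A] [CommRing B] [Algebra K A] [Algebra K B]
    (g : A) (φ : A →ₐ[K] B) (h : ∀ y : Submonoid.powers g, IsUnit (φ y)) :
    (IsLocalization.liftAlgHom (S := Localization.Away g) h).comp
      (IsScalarTower.toAlgHom K A (Localization.Away g)) = φ :=
  AlgHom.ext fun x => IsLocalization.lift_eq _ x

variable (K) in
/-- The open subset `g ≠ 0` of a locally closed subset. -/
noncomputable def equivAway (g : R) (Z : Set R) (f : R) :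
    LocusRing Z (f * g) ≃ₐ[K] Localization.Away (of K Z f g) :=
  have hfg : IsUnit (of K Z (f * g) f * of K Z (f * g) g) := by
    rw [← map_mul]
    exact isUnit_of Z (f * g)
  have hZ : ∀ z ∈ Z, of K Z (f * g) z = 0 := fun _ hz => of_eq_zero _ hz
  equivOfUniversal
    ((IsScalarTower.toAlgHom K (LocusRing Z f) (Localization.Away (of K Z f g))).comp (of K Z f))
    (fun z hz => by simp [of_eq_zero (K := K) f hz])
    (by
      rw [AlgHom.comp_apply, map_mul, map_mul]
      exact ((isUnit_of Z f).map _).mul (IsLocalization.Away.algebraMap_isUnit (of K Z f g)))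
    (IsLocalization.liftAlgHom (M := .powers (of K Z f g))
      (f := lift (of K Z (f * g)) hZ (isUnit_of_mul_isUnit_left hfg)) (by
        rintro ⟨_, n, rfl⟩
        rw [map_pow, lift_of]
        exact (isUnit_of_mul_isUnit_right hfg).pow n))
    (by rw [← AlgHom.comp_assoc, liftAlgHom_comp_toAlgHom, lift_comp_of])
    (IsLocalization.algHom_ext (.powers (of K Z f g)) (algHom_ext (by
      change (((lift _ _ _).comp (IsLocalization.liftAlgHom _)).comp
        (IsScalarTower.toAlgHom K _ _)).comp _ =
        ((AlgHom.id K _).comp (IsScalarTower.toAlgHom K _ _)).comp _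
      rw [AlgHom.comp_assoc _ _ (IsScalarTower.toAlgHom K _ _), liftAlgHom_comp_toAlgHom, AlgHom.comp_assoc,
        lift_comp_of, lift_comp_of, AlgHom.id_comp])))

end LocusRing

/-- Additivity: a locally closed subset is the union of its intersections with `g = 0` and
`g ≠ 0`. -/
lemma locusClass_split (g : R) (Z : Set R) (f : R) :
    locusClass K Z f = locusClass K (insert g Z) f + locusClass K Z (f * g) := by
  rw [locusClass, affineClass_eq_add (LocusRing.of K Z f g),
    ← affineClass_congr (LocusRing.equivQuotient K g Z f),
    ← affineClass_congr (LocusRing.equivAway K g Z f)]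
  rfl

/-- The piece `g ≠ 0` has no points, so its class is zero. On the locus `g` may be a nonzero
nilpotent: this is how classes forget nilpotents. -/
lemma locusClass_insert {Z : Set R} {f g : R}
    (h : ∀ (F : Type u) [Field F] (φ : R →+* F), IsPointOf Z f φ → φ g = 0) :
    locusClass K Z f = locusClass K (insert g Z) f := by
  rw [locusClass_split g, add_eq_left]
  refine locusClass_eq_zero fun F _ φ hφ => hφ.2 ?_
  rw [map_mul, h F φ ⟨hφ.1, fun h0 => hφ.2 (by rw [map_mul, h0, zero_mul])⟩, mul_zero]

lemma locusClass_mul {Z : Set R} {f g : R}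
    (h : ∀ (F : Type u) [Field F] (φ : R →+* F), IsPointOf Z f φ → φ g ≠ 0) :
    locusClass K Z f = locusClass K Z (f * g) := by
  rw [locusClass_split g, add_eq_right]
  exact locusClass_eq_zero fun F _ φ hφ =>
    h F φ ⟨fun z hz => hφ.1 z (Set.mem_insert_of_mem _ hz), hφ.2⟩ (hφ.1 g (Set.mem_insert _ _))

/-- Additivity adjoins one equation at a time, whence the finiteness of `W`. -/
lemma locusClass_union {Z W : Set R} {f : R} (hW : W.Finite)
    (h : ∀ (F : Type u) [Field F] (φ : R →+* F), IsPointOf Z f φ → ∀ w ∈ W, φ w = 0) :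
    locusClass K Z f = locusClass K (W ∪ Z) f := by
  induction W, hW using Set.Finite.induction_on with
  | empty => rw [Set.empty_union]
  | @insert w W _ _ ih =>
    rw [ih fun F _ φ hφ w hw => h F φ hφ w (Set.mem_insert_of_mem _ hw), Set.insert_union]
    refine locusClass_insert fun F _ φ hφ => h F φ ⟨fun z hz => hφ.1 z (Or.inr hz), hφ.2⟩ w
      (Set.mem_insert _ _)

/-- The class of a locally closed subset depends only on its points. -/
lemma locusClass_congr {Z W : Set R} {f g : R} (hZ : Z.Finite) (hW : W.Finite)
    (h : ∀ (F : Type u) [Field F] (φ : R →+* F), IsPointOf Z f φ ↔ IsPointOf W g φ) :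
    locusClass K Z f = locusClass K W g := by
  -- Both sides are brought to the locus cut out by all the equations together with `f * g ≠ 0`.
  rw [locusClass_union hW fun F _ φ hφ => ((h F φ).mp hφ).1,
    locusClass_union hZ fun F _ φ hφ => ((h F φ).mpr hφ).1, Set.union_comm,
    locusClass_mul (f := f) (g := g), locusClass_mul (f := g) (g := f), mul_comm]
  · exact fun F _ φ hφ => ((h F φ).mpr ⟨fun z hz => hφ.1 z (Or.inr hz), hφ.2⟩).2
  · exact fun F _ φ hφ => ((h F φ).mp ⟨fun z hz => hφ.1 z (Or.inl hz), hφ.2⟩).2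

lemma locusClass_congr_algEquiv {S : Type u} [CommRing S] [Algebra K S] [Algebra.FiniteType K S]
    (e : R ≃ₐ[K] S) (Z : Set R) (f : R) : locusClass K Z f = locusClass K (e '' Z) (e f) := by
  have h₁ : ∀ z ∈ Z, ((LocusRing.of K (e '' Z) (e f)).comp e.toAlgHom) z = 0 := fun z hz =>
    LocusRing.of_eq_zero (K := K) _ (Set.mem_image_of_mem e hz)
  have h₂ : IsUnit (((LocusRing.of K (e '' Z) (e f)).comp e.toAlgHom) f) :=
    LocusRing.isUnit_of (K := K) (e '' Z) (e f)
  have h₃ : ∀ z ∈ e '' Z, ((LocusRing.of K Z f).comp e.symm.toAlgHom) z = 0 := by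
    rintro _ ⟨z, hz, rfl⟩
    simpa using LocusRing.of_eq_zero f hz
  have h₄ : IsUnit (((LocusRing.of K Z f).comp e.symm.toAlgHom) (e f)) := by
    simpa using LocusRing.isUnit_of Z f
  refine affineClass_congr (LocusRing.equivOfUniversal _ h₁ h₂ (LocusRing.lift _ h₃ h₄) ?_ ?_)
  · ext x; simp
  · refine LocusRing.algHom_ext ?_
    ext x; simp

/-- The product of a locally closed subset with the affine line. -/
lemma locusClass_polynomial (Z : Set R) (f : R) :
    locusClass K (Polynomial.C '' Z) (Polynomial.C f) =
      affineClass K K[X] * locusClass K Z f := by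
  rw [locusClass, locusClass, ← affineClass_polynomial]
  set o := LocusRing.of K (Polynomial.C '' Z) (Polynomial.C f) with ho
  have h₁ : ∀ z ∈ Polynomial.C '' Z, Polynomial.mapAlgHom (LocusRing.of K Z f) z = 0 := by
    rintro _ ⟨z, hz, rfl⟩
    simp [LocusRing.of_eq_zero (K := K) f hz]
  have h₂ : IsUnit (Polynomial.mapAlgHom (LocusRing.of K Z f) (Polynomial.C f)) := by
    simpa using (LocusRing.isUnit_of (K := K) Z f).map (Polynomial.C (R := LocusRing Z f))
  have h₃ : ∀ z ∈ Z, (o.comp Polynomial.CAlgHom) z = 0 := fun z hz =>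
    LocusRing.of_eq_zero (K := K) _ (Set.mem_image_of_mem _ hz)
  have h₄ : IsUnit ((o.comp Polynomial.CAlgHom) f) := LocusRing.isUnit_of (K := K) _ (Polynomial.C f)
  refine affineClass_congr (LocusRing.equivOfUniversal _ h₁ h₂
    (Polynomial.aevalTower (LocusRing.lift _ h₃ h₄) (o Polynomial.X)) ?_ ?_)
  · ext x <;> simp [← ho]
  · refine Polynomial.algHom_ext' (LocusRing.algHom_ext ?_) ?_
    · ext x; simp [ho]
    · simp [ho]

/-- The graph of the function `- b / a` on a locally closed subset where `a` is invertible. -/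
lemma locusClass_graph {Z : Set R} {f a : R} (b : R)
    (ha : ∀ (F : Type u) [Field F] (φ : R →+* F), IsPointOf Z f φ → φ a ≠ 0) :
    locusClass K (insert (Polynomial.C a * Polynomial.X + Polynomial.C b) (Polynomial.C '' Z))
      (Polynomial.C f) = locusClass K Z f := by
  have hu : IsUnit (LocusRing.of K Z f a) := LocusRing.isUnit_of_ne_zero ha
  obtain ⟨v, hv⟩ := hu.exists_right_inv
  set p := Polynomial.C a * Polynomial.X + Polynomial.C b with hp
  set o := LocusRing.of K (insert p (Polynomial.C '' Z)) (Polynomial.C f) with ho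
  set q := Polynomial.aevalTower (LocusRing.of K Z f) (- LocusRing.of K Z f b * v) with hq
  have h₁ : ∀ z ∈ insert p (Polynomial.C '' Z), q z = 0 := by
    intro w hw
    rcases Set.mem_insert_iff.mp hw with rfl | ⟨z, hz, rfl⟩
    · simp only [hp, hq, map_add, map_mul, Polynomial.aevalTower_C, Polynomial.aevalTower_X]
      linear_combination (- LocusRing.of K Z f b) * hv
    · simpa [hq] using LocusRing.of_eq_zero f hz
  have h₂ : IsUnit (q (Polynomial.C f)) := by simpa [hq] using LocusRing.isUnit_of Z f
  have h₃ : ∀ z ∈ Z, (o.comp Polynomial.CAlgHom) z = 0 := fun z hz =>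
    LocusRing.of_eq_zero (K := K) _ (Set.mem_insert_of_mem _ (Set.mem_image_of_mem _ hz))
  have h₄ : IsUnit ((o.comp Polynomial.CAlgHom) f) := LocusRing.isUnit_of (K := K) _ (Polynomial.C f)
  refine affineClass_congr (LocusRing.equivOfUniversal q h₁ h₂ (LocusRing.lift _ h₃ h₄) ?_ ?_)
  · refine Polynomial.algHom_ext' ?_ ?_
    · ext x; simp [hq, ← ho]
    · have h₀ : o p = 0 := LocusRing.of_eq_zero (K := K) _ (Set.mem_insert _ _)
      have hv' := congrArg (LocusRing.lift _ h₃ h₄) hv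
      simp only [hp, hq, ← ho, map_mul, map_add, map_one, LocusRing.lift_of, AlgHom.comp_apply,
        Polynomial.CAlgHom_apply, map_neg, Polynomial.aevalTower_X] at hv' h₀ ⊢
      -- Multiplying `a X + b = 0` by the inverse `v` of `a` forces `X = - b v`.
      linear_combination o Polynomial.X * hv' - (LocusRing.lift _ h₃ h₄ v) * h₀
  · refine LocusRing.algHom_ext ?_
    ext x; simp [ho, hq]

/-- The locus over which a linear polynomial does not vanish is a bundle of tori. -/
lemma locusClass_linear_ne_zero {Z : Set R} {f a : R} (b : R)
    (ha : ∀ (F : Type u) [Field F] (φ : R →+* F), IsPointOf Z f φ → φ a ≠ 0) :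
    locusClass K (Polynomial.C '' Z)
      (Polynomial.C f * (Polynomial.C a * Polynomial.X + Polynomial.C b)) =
      (affineClass K K[X] - 1) * locusClass K Z f := by
  -- The product with the line, minus the graph of `- b / a`, which has the class of the base.
  have h := locusClass_split (K := K) (Polynomial.C a * Polynomial.X + Polynomial.C b)
    (Polynomial.C '' Z) (Polynomial.C f)
  rw [locusClass_graph b ha, locusClass_polynomial] at h
  linear_combination -h

end Locus

/-! ### Hypersurface complements and the class of the affine line -/

section HypersurfaceComplement

variable {K : Type u} [Field K] {R : Type u} [CommRing R] [Algebra K R]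

variable (K) in
/-- The coordinate ring of a principal open subset as a locus ring. -/
noncomputable def LocusRing.equivLocalizationAway (f : R) :
    LocusRing ∅ f ≃ₐ[K] Localization.Away f :=
  have h₁ : ∀ z ∈ (∅ : Set R), IsScalarTower.toAlgHom K R (Localization.Away f) z = 0 :=
    fun _ h => h.elim
  have h₂ : IsUnit (IsScalarTower.toAlgHom K R (Localization.Away f) f) :=
    IsLocalization.Away.algebraMap_isUnit f
  have h₃ : ∀ y : Submonoid.powers f, IsUnit (LocusRing.of K ∅ f y) := by
    rintro ⟨_, n, rfl⟩
    rw [map_pow]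
    exact (LocusRing.isUnit_of ∅ f).pow n
  LocusRing.equivOfUniversal (IsScalarTower.toAlgHom K R (Localization.Away f)) h₁ h₂
    (IsLocalization.liftAlgHom h₃) (LocusRing.liftAlgHom_comp_toAlgHom _ _ _)
    (IsLocalization.algHom_ext (.powers f) (by
      change (((LocusRing.lift _ h₁ h₂).comp (IsLocalization.liftAlgHom h₃))).comp
        (IsScalarTower.toAlgHom K R (Localization.Away f)) = _
      rw [AlgHom.comp_assoc, LocusRing.liftAlgHom_comp_toAlgHom, LocusRing.lift_comp_of]
      rfl))

variable [Algebra.FiniteType K R]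

lemma varietyClass_hypersurfaceComplement_eq_locusClass (f : R) :
    varietyClass (hypersurfaceComplement K f) = locusClass K ∅ f := by
  rw [varietyClass_hypersurfaceComplement, locusClass]
  exact (affineClass_congr (LocusRing.equivLocalizationAway K f)).symm

variable (K) in
lemma locusClass_field_one : locusClass K (∅ : Set K) 1 = 1 := by
  rw [locusClass, affineClass_congr (LocusRing.equivLocalizationAway K (1 : K)),
    ← affineClass_congr (K := K) ((IsLocalization.atUnit K (Localization.Away (1 : K)) 1
      isUnit_one).restrictScalars K), affineClass_field]

-- Over a point, with `a = 1` and `b = 0`, the bundle of tori is the punctured line, so `𝕋 = [𝔸¹] -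
-- 1`.
variable (K) in
lemma affineClass_line : affineClass K K[X] = torusClass K + 1 := by
  have h := locusClass_linear_ne_zero (K := K) (R := K) (Z := ∅) (f := 1) (a := 1) 0
    (fun F _ φ _ => by simp)
  rw [locusClass_field_one] at h
  rw [torusClass, varietyClass_hypersurfaceComplement_eq_locusClass]
  simp only [Set.image_empty, map_one, map_zero, one_mul, add_zero, mul_one] at h
  rw [h, sub_add_cancel]

end HypersurfaceComplement

/-! ### Adding one coordinate to an affine space -/

section AffineSpace

open MvPolynomial

variable {K : Type u} [Field K] {σ : Type}

variable (K σ) in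
/-- Polynomials in one more variable, as polynomials over polynomials. -/
noncomputable def optionPolyEquiv [Finite σ] :
    Polynomial (MvPolynomial σ K) ≃ₐ[K] MvPolynomial (Option σ) K :=
  (optionEquivLeft K σ).symm

@[simp]
lemma optionPolyEquiv_C [Finite σ] (p : MvPolynomial σ K) :
    optionPolyEquiv K σ (Polynomial.C p) = rename some p := by
  rw [optionPolyEquiv, AlgEquiv.symm_apply_eq]
  have : (Polynomial.CAlgHom : MvPolynomial σ K →ₐ[K] _) =
      (optionEquivLeft K σ).toAlgHom.comp (rename some) := by
    ext i : 1
    simp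
  exact DFunLike.congr_fun this p

@[simp]
lemma optionPolyEquiv_X [Finite σ] : optionPolyEquiv K σ Polynomial.X = X none := by
  simp [optionPolyEquiv]

variable [Finite σ]

lemma locusClass_rename_some (Z : Set (MvPolynomial σ K)) (f : MvPolynomial σ K) :
    locusClass K (rename some '' Z) (rename (R := K) (some : σ → Option σ) f) =
      (torusClass K + 1) * locusClass K Z f := by
  rw [← affineClass_line, ← locusClass_polynomial,
    locusClass_congr_algEquiv (optionPolyEquiv K σ), Set.image_image]
  simp

lemma locusClass_insert_linear {Z : Set (MvPolynomial σ K)} {f a : MvPolynomial σ K}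
    (b : MvPolynomial σ K)
    (ha : ∀ (F : Type u) [Field F] (φ : MvPolynomial σ K →+* F), IsPointOf Z f φ → φ a ≠ 0) :
    locusClass K (insert (rename some a * X none + rename some b) (rename some '' Z))
      (rename (R := K) (some : σ → Option σ) f) = locusClass K Z f := by
  rw [← locusClass_graph b ha, locusClass_congr_algEquiv (optionPolyEquiv K σ),
    Set.image_insert_eq, Set.image_image]
  simp

lemma locusClass_mul_linear {Z : Set (MvPolynomial σ K)} {f a : MvPolynomial σ K}
    (b : MvPolynomial σ K)
    (ha : ∀ (F : Type u) [Field F] (φ : MvPolynomial σ K →+* F), IsPointOf Z f φ → φ a ≠ 0) :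
    locusClass K (rename some '' Z)
      (rename some f * (rename some a * X none + rename (some : σ → Option σ) b)) =
      torusClass K * locusClass K Z f := by
  have h := locusClass_linear_ne_zero (K := K) b ha
  rw [affineClass_line, add_sub_cancel_right] at h
  rw [← h, locusClass_congr_algEquiv (optionPolyEquiv K σ), Set.image_image]
  simp

/-- The class of the complement of `t A + B = 0`. -/
lemma locusClass_linear (A B : MvPolynomial σ K) :
    locusClass K ∅ (rename some A * X none + rename (some : σ → Option σ) B) =
      torusClass K * locusClass K ∅ A + (torusClass K + 1) * locusClass K {A} B := by
  have h₁ : locusClass K {rename some A} (rename some A * X none + rename some B) =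
      locusClass K (rename some '' {A}) (rename (some : σ → Option σ) B) :=
    locusClass_congr (Set.toFinite _) (Set.toFinite _) fun F _ φ => by
      simp only [IsPointOf, Set.image_singleton, Set.mem_singleton_iff, forall_eq, map_add,
        map_mul]
      grind
  have h₂ : locusClass K ∅ ((rename some A * X none + rename some B) * rename some A) =
      locusClass K (rename some '' ∅)
        (rename some A * (rename some A * X none + rename (some : σ → Option σ) B)) := by
    rw [mul_comm, Set.image_empty]
  -- On `A = 0` the condition reads `B ≠ 0` and the new variable is free; on `A ≠ 0` it avoids only
  -- `- B / A`.
  rw [locusClass_split (rename some A), insert_empty_eq, h₁, h₂, locusClass_rename_some,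
    locusClass_mul_linear B fun F _ φ h => h.2]
  ring

end AffineSpace

/-! ### Eliminating the two outer edges of a bananification -/

section Bananification

open MvPolynomial

variable {K : Type u} [Field K] {σ : Type}

/-- The coefficient of `z` in the Kirchhoff polynomial of a `(1,3,1)`-bananification, where `x`,
`y` and `z` are the parallel edges; the remaining two variables enter through their sum. -/
noncomputable def bananaCoeffOne (x y A B : MvPolynomial σ K) :
    MvPolynomial (Option (Option σ)) K :=
  rename (some ∘ some) (x + y) *
      ((X none + X (some none)) * rename (some ∘ some) A + rename (some ∘ some) B) +
    rename (some ∘ some) (x * y * A)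

/-- The part without `z` of the Kirchhoff polynomial of a `(1,3,1)`-bananification. -/
noncomputable def bananaCoeffZero (x y A B : MvPolynomial σ K) :
    MvPolynomial (Option (Option σ)) K :=
  rename (some ∘ some) (x * y) *
    ((X none + X (some none)) * rename (some ∘ some) A + rename (some ∘ some) B)

variable [Finite σ]

/-- If `A = 0`, the equation is automatic and `(x + y)B ≠ 0` remains. If `A ≠ 0`, then `y = -x`, and
`xyA ≠ 0` amounts to `x ≠ 0`. -/
lemma locusClass_add_mul_add (x y A B : MvPolynomial σ K) :
    locusClass K {(x + y) * A} ((x + y) * B + x * y * A) =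
      locusClass K {A} ((x + y) * B) + locusClass K {x + y} (x * A) := by
  rw [locusClass_split A]
  congr 1
  all_goals
    refine locusClass_congr (Set.toFinite _) (Set.toFinite _) fun F _ φ => ?_
    simp only [IsPointOf, Set.mem_insert_iff, Set.mem_singleton_iff, forall_eq_or_imp, forall_eq,
        map_add, map_mul]
    grind

/-- The polynomial is linear in each outer variable with the same leading coefficient `(x + y)A`.
Where this vanishes, neither outer variable occurs any more. -/
lemma locusClass_bananaCoeffOne (x y A B : MvPolynomial σ K) :
    locusClass K ∅ (bananaCoeffOne x y A B) = (torusClass K + 1) *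
      (torusClass K * locusClass K ∅ ((x + y) * A) + (torusClass K + 1) *
        (locusClass K {A} ((x + y) * B) + locusClass K {x + y} (x * A))) := by
  have h₀ : bananaCoeffOne x y A B = rename some (rename some ((x + y) * A)) * X none +
      rename some (rename some ((x + y) * A) * X none + rename some ((x + y) * B + x * y * A)) := by
    simp only [bananaCoeffOne, map_add, map_mul, rename_rename, rename_X]
    ring
  have h₁ : locusClass K {rename some ((x + y) * A)}
      (rename some ((x + y) * A) * X none + rename some ((x + y) * B + x * y * A)) =
      locusClass K (rename some '' {(x + y) * A})
        (rename (some : σ → Option σ) ((x + y) * B + x * y * A)) :=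
    locusClass_congr (Set.toFinite _) (Set.toFinite _) fun F _ φ => by
      simp only [IsPointOf, Set.image_singleton, Set.mem_singleton_iff, forall_eq, map_add,
        map_mul]
      grind
  have h₂ := locusClass_rename_some (K := K) ∅ ((x + y) * A)
  rw [Set.image_empty] at h₂
  rw [h₀, locusClass_linear, h₁, h₂, locusClass_rename_some, locusClass_add_mul_add]
  ring

/-- With `w = (u + v)a + b`, the equation is `(x + y)w + xya = 0`. So `w = 0` would force `xya = 0`:
the condition `w ≠ 0` is redundant once `x`, `y`, `a` are nonzero. -/
lemma and_ne_zero_iff_and_ne_zero {F : Type*} [Field F] (x y u v a b : F) :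
    ((x + y) * ((u + v) * a + b) + x * y * a = 0 ∧
      x * y * ((u + v) * a + b) * ((x + y) * a) ≠ 0) ↔
    ((x + y) * a * u + ((x + y) * a * v + ((x + y) * b + x * y * a)) = 0 ∧
      (x + y) * a * x * y ≠ 0) := by
  have h : (x + y) * a * u + ((x + y) * a * v + ((x + y) * b + x * y * a)) =
    (x + y) * ((u + v) * a + b) + x * y * a := by ring
  rw [h]
  generalize (u + v) * a + b = w
  simp only [ne_eq, mul_eq_zero, not_or]
  refine and_congr_right fun h₀ => ⟨by tauto, fun h => ?_⟩
  have : w ≠ 0 := by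
    rintro rfl
    simp_all
  tauto

/-- Where `(x + y)A ≠ 0`, the equation is solved for one outer variable and the other is free. Where
`(x + y)A = 0`, the conditions force both `x + y = 0` and `A = 0`, leaving `xB ≠ 0` with both outer
variables free. -/
lemma locusClass_bananaCoeffZero (x y A B : MvPolynomial σ K) :
    locusClass K {bananaCoeffOne x y A B} (bananaCoeffZero x y A B) =
      (torusClass K + 1) * (locusClass K ∅ ((x + y) * A * x * y) +
        (torusClass K + 1) * locusClass K {x + y, A} (x * B)) := by
  rw [locusClass_split (rename some (rename some ((x + y) * A)))]
  have h₁ : locusClass K (insert (rename some (rename some ((x + y) * A)))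
      {bananaCoeffOne x y A B}) (bananaCoeffZero x y A B) =
      locusClass K (rename some '' (rename some '' {x + y, A}))
        (rename (some : Option σ → _) (rename some (x * B))) :=
    locusClass_congr (Set.toFinite _) (Set.toFinite _) fun F _ φ => by
      simp only [IsPointOf, Set.image_singleton, Set.mem_singleton_iff, forall_eq, map_add,
        map_mul, bananaCoeffOne, bananaCoeffZero, rename_rename, Set.image_insert_eq,
        Set.mem_insert_iff, forall_eq_or_imp]
      grind
  have h₂ : locusClass K {bananaCoeffOne x y A B}
      (bananaCoeffZero x y A B * rename some (rename some ((x + y) * A))) =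
      locusClass K (insert (rename some (rename some ((x + y) * A)) * X none + rename some
          (rename some ((x + y) * A) * X none + rename some ((x + y) * B + x * y * A)))
        (rename some '' ∅)) (rename (some : Option σ → _) (rename some ((x + y) * A * x * y))) :=
    locusClass_congr (Set.toFinite _) (Set.toFinite _) fun F _ φ => by
      simp only [IsPointOf, Set.image_empty, insert_empty_eq, Set.mem_singleton_iff, forall_eq,
        map_add, map_mul, bananaCoeffOne, bananaCoeffZero, rename_rename, rename_X]
      exact and_ne_zero_iff_and_ne_zero _ _ _ _ _ _
  have h₃ := locusClass_rename_some (K := K) ∅ ((x + y) * A * x * y)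
  rw [Set.image_empty] at h₃
  rw [h₁, h₂, locusClass_rename_some, locusClass_rename_some, locusClass_insert_linear, h₃]
  · ring
  · intro F _ φ h
    have := h.2
    simp only [map_mul] at this ⊢
    grind

end Bananification

/-! ### Eliminating the two unmarked parallel edges -/

section TwoVariables

open MvPolynomial

variable {K : Type u} [Field K] {σ : Type} [Finite σ] (A B : MvPolynomial σ K)

lemma locusClass_add_mul (Z : Set (MvPolynomial σ K)) :
    locusClass K (rename some '' (rename some '' Z))
      ((X none + X (some none)) * rename some (rename (some : σ → _) A)) =
      torusClass K * (torusClass K + 1) * locusClass K Z A := by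
  have h : (X none + X (some none)) * rename some (rename (some : σ → _) A) =
      rename some (rename some A) *
        (rename some 1 * X none + rename some (X none : MvPolynomial (Option σ) K)) := by
    rw [map_one, rename_X]
    ring
  rw [h, locusClass_mul_linear _ fun F _ φ _ => by simp, locusClass_rename_some]
  ring

/-- The equation eliminates one variable as minus the other, which ranges over a torus. -/
lemma locusClass_insert_add {Z : Set (MvPolynomial σ K)} (hZ : Z.Finite) :
    locusClass K (insert (X none + X (some none)) (rename some '' (rename some '' Z)))
      (X none * rename some (rename (some : σ → _) A)) = torusClass K * locusClass K Z A := by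
  have h₁ := locusClass_mul_linear (Z := Z) (f := A) (a := 1) 0 fun F _ φ _ => by simp
  have h₂ := locusClass_insert_linear (Z := rename some '' Z)
    (f := rename (some : σ → _) A * (rename some 1 * X none + rename some 0)) (a := 1)
    (X none) fun F _ φ _ => by simp
  simp only [map_one, map_zero, one_mul, add_zero, map_mul, rename_X] at h₁ h₂
  rw [← h₁, ← h₂]
  have hfin : (rename (R := K) (some : Option σ → _) '' (rename some '' Z)).Finite :=
    (hZ.image _).image _
  refine locusClass_congr (Set.Finite.insert _ hfin) (Set.Finite.insert _ hfin) fun F _ φ => ?_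
  simp only [IsPointOf, Set.mem_insert_iff, forall_eq_or_imp, map_add, map_mul, and_assoc]
  refine and_congr_right fun h => and_congr_right fun _ => ?_
  rw [eq_neg_of_add_eq_zero_left h, mul_comm, mul_neg, neg_ne_zero]

/-- The torus `xy ≠ 0` of class `𝕋²` loses the antidiagonal `x + y = 0`, of class `𝕋`. -/
lemma locusClass_add_mul_mul_mul :
    locusClass K ∅ ((X none + X (some none)) * rename some (rename some A) * X none *
      X (some none)) = torusClass K * (torusClass K - 1) * locusClass K ∅ A := by
  have h₁ := locusClass_split (K := K) (X none + X (some none)) ∅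
    (rename some (rename (some : σ → _) A) * X none * X (some none))
  have h₂ := locusClass_mul_linear (K := K) (Z := ∅) (f := rename (some : σ → _) A * X none)
    (a := 1) 0 fun F _ φ _ => by simp
  have h₃ := locusClass_mul_linear (K := K) (Z := ∅) (f := A) (a := 1) 0 fun F _ φ _ => by simp
  have h₄ := locusClass_insert_add A (Set.finite_empty)
  have h₅ : locusClass K {X none + X (some none)} (X none * rename some (rename some A)) =
      locusClass K {X none + X (some none)}
        (rename some (rename (some : σ → _) A) * X none * X (some none)) :=
    locusClass_congr (Set.toFinite _) (Set.toFinite _) fun F _ φ => by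
      simp only [IsPointOf, Set.mem_singleton_iff, forall_eq, map_add, map_mul]
      grind
  simp only [Set.image_empty, map_one, map_zero, one_mul, add_zero, map_mul, rename_X,
    insert_empty_eq] at h₁ h₂ h₃ h₄
  have h₆ : (X none + X (some none)) * rename some (rename some A) * X none * X (some none) =
    rename some (rename (some : σ → _) A) * X none * X (some none) *
      (X none + X (some none)) := by ring
  have h₇ : rename some (rename (some : σ → _) A) * X none * X (some none) =
    rename some (rename (some : σ → _) A) * X (some none) * X none := by ring
  rw [h₆]
  rw [← h₅, h₄, h₇, h₂, h₃, ← h₇] at h₁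
  linear_combination -h₁

end TwoVariables

/-! ### The recursion for the pair of classes -/

section Recursion

open MvPolynomial

variable {K : Type u} [Field K] {σ : Type} [Finite σ] (A B : MvPolynomial σ K)

/-- The effect of a `(1,3,1)`-bananification on the class of the locus where the coefficient of
the marked edge does not vanish. -/
lemma locusClass_bananification_coeffOne :
    locusClass K ∅ (bananaCoeffOne (X none) (X (some none))
      (rename some (rename some A)) (rename some (rename some B))) =
      torusClass K * (torusClass K + 1) ^ 3 * (locusClass K ∅ A + locusClass K {A} B) := by
  have h₁ := locusClass_add_mul A ∅
  have h₂ := locusClass_add_mul B {A}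
  have h₃ := locusClass_insert_add A Set.finite_empty
  simp only [Set.image_empty, Set.image_singleton, insert_empty_eq] at h₁ h₂ h₃
  rw [locusClass_bananaCoeffOne, h₁, h₂, h₃]
  ring

/-- The effect of a `(1,3,1)`-bananification on the class of the locus where the coefficient of
the marked edge vanishes, but the Kirchhoff polynomial does not. -/
lemma locusClass_bananification_coeffZero :
    locusClass K {bananaCoeffOne (X none) (X (some none)) (rename some (rename some A))
        (rename some (rename some B))}
      (bananaCoeffZero (X none) (X (some none)) (rename some (rename some A))
        (rename some (rename some B))) =
      torusClass K * (torusClass K - 1) * (torusClass K + 1) * locusClass K ∅ A +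
        torusClass K * (torusClass K + 1) ^ 2 * locusClass K {A} B := by
  have h₁ := locusClass_insert_add B (Set.finite_singleton A)
  simp only [Set.image_singleton] at h₁
  rw [locusClass_bananaCoeffZero, locusClass_add_mul_mul_mul, h₁]
  ring

end Recursion

/-! ### Connectivity of graphs and of bananifications -/

namespace Multigraph

section Joined

variable {G H : Multigraph}

lemma Joined.refl (S : Set G.E) (x : G.V) : G.Joined S x x := Relation.EqvGen.refl x

lemma Joined.symm {S : Set G.E} {x y : G.V} (h : G.Joined S x y) : G.Joined S y x :=
  Relation.EqvGen.symm _ _ h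

lemma Joined.trans {S : Set G.E} {x y z : G.V} (h : G.Joined S x y) (h' : G.Joined S y z) :
    G.Joined S x z := Relation.EqvGen.trans _ _ _ h h'

lemma Joined.of_mem {S : Set G.E} {f : G.E} (h : f ∈ S) : G.Joined S (G.src f) (G.tgt f) :=
  Relation.EqvGen.rel _ _ ⟨f, h, rfl, rfl⟩

/-- A map of vertices preserves being joined when it does so for the end points of edges. -/
lemma Joined.map {S : Set G.E} {T : Set H.E} (ρ : G.V → H.V)
    (h : ∀ f ∈ S, H.Joined T (ρ (G.src f)) (ρ (G.tgt f))) {x y : G.V} (hxy : G.Joined S x y) :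
    H.Joined T (ρ x) (ρ y) := by
  induction hxy with
  | rel x y h' =>
    obtain ⟨f, hf, rfl, rfl⟩ := h'
    exact h f hf
  | refl x => exact .refl T _
  | symm x y _ ih => exact ih.symm
  | trans x y z _ _ ih₁ ih₂ => exact ih₁.trans ih₂

/-- A function of the vertices which agrees at the end points of edges is constant on
components. -/
lemma Joined.apply_eq {α : Type*} {S : Set G.E} (φ : G.V → α)
    (h : ∀ f ∈ S, φ (G.src f) = φ (G.tgt f)) {x y : G.V} (hxy : G.Joined S x y) :
    φ x = φ y := by
  induction hxy with
  | rel x y h' =>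
    obtain ⟨f, hf, rfl, rfl⟩ := h'
    exact h f hf
  | refl x => rfl
  | symm x y _ ih => exact ih.symm
  | trans x y z _ _ ih₁ ih₂ => exact ih₁.trans ih₂

/-- Both maps descend to components, and `ι ∘ ρ` is the identity there, so `ρ` is injective on
components. It serves to collapse the string onto the old graph. -/
lemma joined_iff_of_retract {S : Set G.E} {T : Set H.E} (ρ : G.V → H.V) (ι : H.V → G.V)
    (h₁ : ∀ f ∈ S, H.Joined T (ρ (G.src f)) (ρ (G.tgt f)))
    (h₂ : ∀ f ∈ T, G.Joined S (ι (H.src f)) (ι (H.tgt f)))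
    (h₃ : ∀ x, G.Joined S x (ι (ρ x))) (x y : G.V) :
    G.Joined S x y ↔ H.Joined T (ρ x) (ρ y) :=
  ⟨Joined.map ρ h₁, fun h => (h₃ x).trans ((Joined.map ι h₂ h).trans (h₃ y).symm)⟩

end Joined

section Bananify

variable (G : Multigraph) (e : G.E)

/-- The first edge of the string replacing `e`. -/
def firstEdge : (G.bananify131 e).E := Sum.inr ⟨0, (0 : Fin 1)⟩

/-- The last edge of the string replacing `e`. -/
def lastEdge : (G.bananify131 e).E := Sum.inr ⟨2, (0 : Fin 1)⟩

/-- An edge different from `e`, as an edge of the bananification at `e`. -/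
def oldEdge (f : {x : G.E // x ≠ e}) : (G.bananify131 e).E := Sum.inl f

/-- A vertex, as a vertex of the bananification. -/
def oldVertex (v : G.V) : (G.bananify131 e).V := Sum.inl v

/-- The two vertices created by a bananification. -/
def newVertex (i : Fin 2) : (G.bananify131 e).V := Sum.inr i

variable {G e}

lemma gadget_cases {P : (Σ i : Fin 3, Fin (![1, 3, 1] i)) → Prop} (h₀ : P ⟨0, (0 : Fin 1)⟩)
    (h₁ : ∀ c : Fin 3, P ⟨1, c⟩) (h₂ : P ⟨2, (0 : Fin 1)⟩) : ∀ p, P p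
  | ⟨0, c⟩ => by
    rw [show c = (0 : Fin 1) from Subsingleton.elim (α := Fin 1) _ _]
    exact h₀
  | ⟨1, c⟩ => h₁ c
  | ⟨2, c⟩ => by
    rw [show c = (0 : Fin 1) from Subsingleton.elim (α := Fin 1) _ _]
    exact h₂

lemma bananify131_edge_cases {P : (G.bananify131 e).E → Prop} (h : ∀ f, P (G.oldEdge e f))
    (h₀ : P (G.firstEdge e)) (h₁ : ∀ c, P (G.middleEdge e c)) (h₂ : P (G.lastEdge e)) :
    ∀ f, P f
  | .inl f => h f
  | .inr p => gadget_cases (P := fun p => P (Sum.inr p)) h₀ h₁ h₂ p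

lemma bananify131_vertex_cases {P : (G.bananify131 e).V → Prop} (h : ∀ v, P (G.oldVertex e v))
    (h₀ : P (G.newVertex e 0)) (h₁ : P (G.newVertex e 1)) : ∀ v, P v
  | .inl v => h v
  | .inr 0 => h₀
  | .inr 1 => h₁

@[simp] lemma src_oldEdge (f) :
    (G.bananify131 e).src (G.oldEdge e f) = G.oldVertex e (G.src f) := rfl
@[simp] lemma tgt_oldEdge (f) :
    (G.bananify131 e).tgt (G.oldEdge e f) = G.oldVertex e (G.tgt f) := rfl
@[simp] lemma src_firstEdge :
    (G.bananify131 e).src (G.firstEdge e) = G.oldVertex e (G.src e) := rfl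
@[simp] lemma tgt_firstEdge :
    (G.bananify131 e).tgt (G.firstEdge e) = G.newVertex e 0 := rfl
@[simp] lemma src_middleEdge (c) :
    (G.bananify131 e).src (G.middleEdge e c) = G.newVertex e 0 := rfl
@[simp] lemma tgt_middleEdge (c) :
    (G.bananify131 e).tgt (G.middleEdge e c) = G.newVertex e 1 := rfl
@[simp] lemma src_lastEdge :
    (G.bananify131 e).src (G.lastEdge e) = G.newVertex e 1 := rfl
@[simp] lemma tgt_lastEdge :
    (G.bananify131 e).tgt (G.lastEdge e) = G.oldVertex e (G.tgt e) := rfl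

lemma newVertex_injective : Function.Injective (G.newVertex e) := Sum.inr_injective

lemma oldVertex_ne_newVertex (v i) : G.oldVertex e v ≠ G.newVertex e i := Sum.inl_ne_inr

@[simp] lemma firstEdge_ne_lastEdge : G.firstEdge e ≠ G.lastEdge e := fun h => by
  cases Sum.inr.inj h

@[simp] lemma firstEdge_ne_middleEdge (c) : G.firstEdge e ≠ G.middleEdge e c := fun h => by
  cases Sum.inr.inj h

@[simp] lemma lastEdge_ne_middleEdge (c) : G.lastEdge e ≠ G.middleEdge e c := fun h => by
  cases Sum.inr.inj h

@[simp] lemma firstEdge_ne_oldEdge (f) : G.firstEdge e ≠ G.oldEdge e f := Sum.inr_ne_inl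

@[simp] lemma lastEdge_ne_oldEdge (f) : G.lastEdge e ≠ G.oldEdge e f := Sum.inr_ne_inl

@[simp] lemma middleEdge_ne_oldEdge (c f) : G.middleEdge e c ≠ G.oldEdge e f := Sum.inr_ne_inl

@[simp] lemma lastEdge_ne_firstEdge : G.lastEdge e ≠ G.firstEdge e :=
  (firstEdge_ne_lastEdge).symm

@[simp] lemma middleEdge_ne_firstEdge (c) : G.middleEdge e c ≠ G.firstEdge e :=
  (firstEdge_ne_middleEdge _).symm

@[simp] lemma middleEdge_ne_lastEdge (c) : G.middleEdge e c ≠ G.lastEdge e :=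
  (lastEdge_ne_middleEdge _).symm

@[simp] lemma oldEdge_ne_firstEdge (f) : G.oldEdge e f ≠ G.firstEdge e :=
  (firstEdge_ne_oldEdge _).symm

@[simp] lemma oldEdge_ne_lastEdge (f) : G.oldEdge e f ≠ G.lastEdge e :=
  (lastEdge_ne_oldEdge _).symm

@[simp] lemma oldEdge_ne_middleEdge (c f) : G.oldEdge e f ≠ G.middleEdge e c :=
  (middleEdge_ne_oldEdge _ _).symm

lemma middleEdge_injective : Function.Injective (G.middleEdge e) := fun c d h => by
  cases Sum.inr.inj h
  rfl

/-- The edges of `G` among a set of edges of a bananification. -/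
def oldEdges (S : Set (G.bananify131 e).E) : Set G.E := Subtype.val '' (G.oldEdge e ⁻¹' S)

lemma mem_oldEdges {S : Set (G.bananify131 e).E} {f : {x : G.E // x ≠ e}} :
    f.val ∈ oldEdges S ↔ G.oldEdge e f ∈ S := by
  simp only [oldEdges, Subtype.val_injective.mem_set_image, Set.mem_preimage]

lemma oldEdges_diff_oldEdge (S : Set (G.bananify131 e).E) (f : {x : G.E // x ≠ e}) :
    oldEdges (S \ {G.oldEdge e f}) = oldEdges S \ {f.val} := by
  have : G.oldEdge e ⁻¹' (S \ {G.oldEdge e f}) = (G.oldEdge e ⁻¹' S) \ {f} := by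
    ext x
    exact and_congr_right fun _ => not_congr ⟨fun h => Sum.inl.inj h, fun h => congrArg _ h⟩
  rw [oldEdges, this, Set.image_sdiff Subtype.val_injective, Set.image_singleton]
  rfl

lemma oldEdges_diff_inr (S : Set (G.bananify131 e).E) (p) :
    oldEdges (S \ {(Sum.inr p : (G.bananify131 e).E)}) = oldEdges S := by
  have : G.oldEdge e ⁻¹' (S \ {(Sum.inr p : (G.bananify131 e).E)}) = G.oldEdge e ⁻¹' S := by
    ext x
    exact and_iff_left fun h => Sum.inl_ne_inr h
  rw [oldEdges, this, oldEdges]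

lemma oldEdges_diff_firstEdge (S : Set (G.bananify131 e).E) :
    oldEdges (S \ {G.firstEdge e}) = oldEdges S := oldEdges_diff_inr S _

lemma oldEdges_diff_middleEdge (S : Set (G.bananify131 e).E) (c) :
    oldEdges (S \ {G.middleEdge e c}) = oldEdges S := oldEdges_diff_inr S _

lemma oldEdges_diff_lastEdge (S : Set (G.bananify131 e).E) :
    oldEdges (S \ {G.lastEdge e}) = oldEdges S := oldEdges_diff_inr S _

/-- The retraction of the vertices of a bananification onto the old ones which maps the two new
vertices to `u` and `v`. -/
def retract (u v : G.V) : (G.bananify131 e).V → G.V := Sum.elim id ![u, v]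

@[simp] lemma retract_oldVertex (u v w : G.V) : retract (e := e) u v (G.oldVertex e w) = w := rfl
@[simp] lemma retract_newVertex_zero (u v : G.V) :
    retract (e := e) u v (G.newVertex e 0) = u := rfl
@[simp] lemma retract_newVertex_one (u v : G.V) :
    retract (e := e) u v (G.newVertex e 1) = v := rfl

variable {S : Set (G.bananify131 e).E}

lemma joined_oldVertex_of_mem {f : G.E} (hf : f ∈ oldEdges S) :
    (G.bananify131 e).Joined S (G.oldVertex e (G.src f)) (G.oldVertex e (G.tgt f)) := by
  obtain ⟨f, hf, rfl⟩ := hf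
  exact Joined.of_mem hf

/-- A complete string behaves like the edge `e`; both new vertices are slid to its source. -/
lemma joined_iff_of_first_middle_last (h₀ : G.firstEdge e ∈ S) (h₁ : ∃ c, G.middleEdge e c ∈ S)
    (h₂ : G.lastEdge e ∈ S) (x y) : (G.bananify131 e).Joined S x y ↔
      G.Joined (insert e (oldEdges S)) (retract (G.src e) (G.src e) x)
        (retract (G.src e) (G.src e) y) := by
  obtain ⟨c, hc⟩ := h₁
  have j₀ := Joined.of_mem h₀
  have j₁ := Joined.of_mem hc
  have j₂ := Joined.of_mem h₂
  refine joined_iff_of_retract _ (G.oldVertex e) ?_ ?_ ?_ x y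
  · refine bananify131_edge_cases (fun f hf => .of_mem ?_) (fun _ => .refl _ _)
      (fun c _ => .refl _ _) fun _ => .of_mem (Set.mem_insert _ _)
    exact Set.mem_insert_of_mem _ (mem_oldEdges.mpr hf)
  · intro f hf
    rcases Set.mem_insert_iff.mp hf with rfl | hf
    · exact j₀.trans (j₁.trans j₂)
    · exact joined_oldVertex_of_mem hf
  · exact bananify131_vertex_cases (fun _ => .refl _ _) j₀.symm (j₀.trans j₁).symm

/-- Without the last edge the rest of the string dangles from the source of `e` and joins no old
vertices. -/
lemma joined_iff_of_first_middle (h₀ : G.firstEdge e ∈ S) (h₁ : ∃ c, G.middleEdge e c ∈ S)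
    (h₂ : G.lastEdge e ∉ S) (x y) : (G.bananify131 e).Joined S x y ↔
      G.Joined (oldEdges S) (retract (G.src e) (G.src e) x) (retract (G.src e) (G.src e) y) := by
  obtain ⟨c, hc⟩ := h₁
  have j₀ := Joined.of_mem h₀
  have j₁ := Joined.of_mem hc
  refine joined_iff_of_retract _ (G.oldVertex e) ?_ (fun f hf => joined_oldVertex_of_mem hf) ?_ x y
  · exact bananify131_edge_cases (fun f hf => .of_mem (mem_oldEdges.mpr hf)) (fun _ => .refl _ _)
      (fun c _ => .refl _ _) fun h => (h₂ h).elim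
  · exact bananify131_vertex_cases (fun _ => .refl _ _) j₀.symm (j₀.trans j₁).symm

lemma joined_iff_of_middle_last (h₀ : G.firstEdge e ∉ S) (h₁ : ∃ c, G.middleEdge e c ∈ S)
    (h₂ : G.lastEdge e ∈ S) (x y) : (G.bananify131 e).Joined S x y ↔
      G.Joined (oldEdges S) (retract (G.tgt e) (G.tgt e) x) (retract (G.tgt e) (G.tgt e) y) := by
  obtain ⟨c, hc⟩ := h₁
  have j₁ := Joined.of_mem hc
  have j₂ := Joined.of_mem h₂
  refine joined_iff_of_retract _ (G.oldVertex e) ?_ (fun f hf => joined_oldVertex_of_mem hf) ?_ x y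
  · exact bananify131_edge_cases (fun f hf => .of_mem (mem_oldEdges.mpr hf))
      (fun h => (h₀ h).elim) (fun c _ => .refl _ _) fun _ => .refl _ _
  · exact bananify131_vertex_cases (fun _ => .refl _ _) (j₁.trans j₂) j₂

/-- With the middle cut, each new vertex dangles from its own end of `e`. -/
lemma joined_iff_of_first_last (h₀ : G.firstEdge e ∈ S) (h₁ : ∀ c, G.middleEdge e c ∉ S)
    (h₂ : G.lastEdge e ∈ S) (x y) : (G.bananify131 e).Joined S x y ↔
      G.Joined (oldEdges S) (retract (G.src e) (G.tgt e) x) (retract (G.src e) (G.tgt e) y) := by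
  have j₀ := Joined.of_mem h₀
  have j₂ := Joined.of_mem h₂
  refine joined_iff_of_retract _ (G.oldVertex e) ?_ (fun f hf => joined_oldVertex_of_mem hf) ?_ x y
  · exact bananify131_edge_cases (fun f hf => .of_mem (mem_oldEdges.mpr hf)) (fun _ => .refl _ _)
      (fun c h => (h₁ c h).elim) fun _ => .refl _ _
  · exact bananify131_vertex_cases (fun _ => .refl _ _) j₀.symm j₂

lemma not_joined_newVertex_zero (h₀ : G.firstEdge e ∉ S) (h₁ : ∀ c, G.middleEdge e c ∉ S) {x}
    (hx : x ≠ G.newVertex e 0) : ¬ (G.bananify131 e).Joined S x (G.newVertex e 0) := fun h => by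
  refine hx ((Joined.apply_eq (· = G.newVertex e 0) ?_ h).mpr rfl)
  exact bananify131_edge_cases (fun f _ => by simp [oldVertex_ne_newVertex]) (fun h => (h₀ h).elim)
    (fun c h => (h₁ c h).elim) fun _ => by
      simp [newVertex_injective.eq_iff, oldVertex_ne_newVertex]

lemma not_joined_newVertex_one (h₁ : ∀ c, G.middleEdge e c ∉ S) (h₂ : G.lastEdge e ∉ S) {x}
    (hx : x ≠ G.newVertex e 1) : ¬ (G.bananify131 e).Joined S x (G.newVertex e 1) := fun h => by
  refine hx ((Joined.apply_eq (· = G.newVertex e 1) ?_ h).mpr rfl)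
  exact bananify131_edge_cases (fun f _ => by simp [oldVertex_ne_newVertex])
    (fun _ => by simp [newVertex_injective.eq_iff, oldVertex_ne_newVertex]) (fun c h => (h₁ c h).elim) fun h => (h₂ h).elim

lemma not_joined_oldVertex_newVertex (h₀ : G.firstEdge e ∉ S) (h₂ : G.lastEdge e ∉ S) (v i) :
    ¬ (G.bananify131 e).Joined S (G.oldVertex e v) (G.newVertex e i) := fun h => by
  have := Joined.apply_eq (Sum.isLeft : G.V ⊕ Fin 2 → Bool) ?_ h
  · simp [oldVertex, newVertex] at this
  · exact bananify131_edge_cases (fun f _ => rfl) (fun h => (h₀ h).elim) (fun c _ => rfl)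
      fun h => (h₂ h).elim

end Bananify

end Multigraph

/-! ### Spanning trees of a bananification -/

namespace Multigraph

section SpanningTrees

variable {G : Multigraph} {e : G.E} {S : Set (G.bananify131 e).E}

lemma isSpanningTree_bananify131_iff_forall : (G.bananify131 e).IsSpanningTree S ↔
    (∀ x y, (G.bananify131 e).Joined S x y) ∧
    (∀ f, G.oldEdge e f ∈ S → ¬ (G.bananify131 e).Joined (S \ {G.oldEdge e f})
      (G.oldVertex e (G.src f)) (G.oldVertex e (G.tgt f))) ∧
    (G.firstEdge e ∈ S → ¬ (G.bananify131 e).Joined (S \ {G.firstEdge e})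
      (G.oldVertex e (G.src e)) (G.newVertex e 0)) ∧
    (∀ c, G.middleEdge e c ∈ S → ¬ (G.bananify131 e).Joined (S \ {G.middleEdge e c})
      (G.newVertex e 0) (G.newVertex e 1)) ∧
    (G.lastEdge e ∈ S → ¬ (G.bananify131 e).Joined (S \ {G.lastEdge e})
      (G.newVertex e 1) (G.oldVertex e (G.tgt e))) := by
  refine ⟨fun h => ⟨h.2.1, fun f hf => h.2.2 _ hf, h.2.2 _, fun c hc => h.2.2 _ hc, h.2.2 _⟩,
    fun h => ⟨⟨G.newVertex e 0⟩, h.1, ?_⟩⟩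
  exact bananify131_edge_cases h.2.1 h.2.2.1 h.2.2.2.1 h.2.2.2.2

lemma forall_retract_iff (u v : G.V) (P : G.V → G.V → Prop) :
    (∀ x y, P (retract (e := e) u v x) (retract (e := e) u v y)) ↔ ∀ x y, P x y :=
  ⟨fun h x y => h (G.oldVertex e x) (G.oldVertex e y), fun h _ _ => h _ _⟩

lemma notMem_oldEdges : e ∉ oldEdges S := fun ⟨f, _, hf⟩ => f.2 hf

lemma isSpanningTree_oldEdges_iff : G.IsSpanningTree (oldEdges S) ↔
    (∀ x y, G.Joined (oldEdges S) x y) ∧ ∀ f : {x : G.E // x ≠ e}, G.oldEdge e f ∈ S →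
      ¬ G.Joined (oldEdges S \ {f.val}) (G.src f) (G.tgt f) := by
  refine ⟨fun h => ⟨h.2.1, fun f hf => h.2.2 f (mem_oldEdges.mpr hf)⟩,
    fun h => ⟨⟨G.src e⟩, h.1, ?_⟩⟩
  rintro _ ⟨f, hf, rfl⟩
  exact h.2 f hf

lemma isSpanningTree_insert_oldEdges_iff : G.IsSpanningTree (insert e (oldEdges S)) ↔
    (∀ x y, G.Joined (insert e (oldEdges S)) x y) ∧
    (∀ f : {x : G.E // x ≠ e}, G.oldEdge e f ∈ S →
      ¬ G.Joined (insert e (oldEdges S \ {f.val})) (G.src f) (G.tgt f)) ∧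
    ¬ G.Joined (oldEdges S) (G.src e) (G.tgt e) := by
  have he : insert e (oldEdges S) \ {e} = oldEdges S := by
    rw [Set.insert_sdiff_of_mem _ (Set.mem_singleton e), Set.sdiff_singleton_eq_self notMem_oldEdges]
  have hf (f : {x : G.E // x ≠ e}) :
      insert e (oldEdges S) \ {f.val} = insert e (oldEdges S \ {f.val}) :=
    (Set.insert_sdiff_singleton_comm f.2.symm _).symm
  constructor
  · refine fun h => ⟨h.2.1, fun f hS => ?_, ?_⟩
    · rw [← hf]
      exact h.2.2 f (Set.mem_insert_of_mem _ (mem_oldEdges.mpr hS))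
    · have := h.2.2 e (Set.mem_insert _ _)
      rwa [he] at this
  · refine fun h => ⟨⟨G.src e⟩, h.1, fun f hS => ?_⟩
    rcases Set.mem_insert_iff.mp hS with rfl | ⟨f, hf', rfl⟩
    · rw [he]
      exact h.2.2
    · rw [hf]
      exact h.2.1 f hf'

-- Two middle edges form a cycle. With just one, removing any edge of the string cuts the string, so
-- each is a bridge exactly when `e` is one.
variable (S) in
lemma isSpanningTree_bananify131_of_first_middle_last (h₀ : G.firstEdge e ∈ S)
    (h₁ : ∃ c, G.middleEdge e c ∈ S) (h₂ : G.lastEdge e ∈ S) :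
    (G.bananify131 e).IsSpanningTree S ↔
      (∃! c, G.middleEdge e c ∈ S) ∧ G.IsSpanningTree (insert e (oldEdges S)) := by
  have hold (f) : (G.bananify131 e).Joined (S \ {G.oldEdge e f}) (G.oldVertex e (G.src f))
      (G.oldVertex e (G.tgt f)) ↔
        G.Joined (insert e (oldEdges S \ {f.val})) (G.src f) (G.tgt f) := by
    rw [joined_iff_of_first_middle_last (by simpa) (by simpa) (by simpa), oldEdges_diff_oldEdge]
    simp
  have hfirst : (G.bananify131 e).Joined (S \ {G.firstEdge e}) (G.oldVertex e (G.src e))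
      (G.newVertex e 0) ↔ G.Joined (oldEdges S) (G.src e) (G.tgt e) := by
    rw [joined_iff_of_middle_last (by simp) (by simpa )
      (by simpa ), oldEdges_diff_firstEdge]
    simp
  have hlast : (G.bananify131 e).Joined (S \ {G.lastEdge e}) (G.newVertex e 1)
      (G.oldVertex e (G.tgt e)) ↔ G.Joined (oldEdges S) (G.src e) (G.tgt e) := by
    rw [joined_iff_of_first_middle (by simpa) (by simpa )
      (by simp), oldEdges_diff_lastEdge]
    simp
  have hmid (c) (hc : ∀ d, G.middleEdge e d ∈ S → d = c) :
      (G.bananify131 e).Joined (S \ {G.middleEdge e c}) (G.newVertex e 0)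
      (G.newVertex e 1) ↔ G.Joined (oldEdges S) (G.src e) (G.tgt e) := by
    rw [joined_iff_of_first_last (by simpa)
      (fun d hd => hd.2 (by rw [hc d hd.1]; rfl)) (by simpa), oldEdges_diff_middleEdge]
    simp
  have hmid' (c d) (hd : G.middleEdge e d ∈ S) (hcd : d ≠ c) :
      (G.bananify131 e).Joined (S \ {G.middleEdge e c}) (G.newVertex e 0) (G.newVertex e 1) :=
    Joined.of_mem (f := G.middleEdge e d) ⟨hd, fun h => hcd (middleEdge_injective h)⟩
  rw [isSpanningTree_bananify131_iff_forall, isSpanningTree_insert_oldEdges_iff]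
  simp only [joined_iff_of_first_middle_last h₀ h₁ h₂, hold, hfirst, hlast]
  rw [forall_retract_iff _ _ (G.Joined _)]
  constructor
  · rintro ⟨h₃, h₄, h₅, h₆, -⟩
    obtain ⟨c, hc⟩ := h₁
    refine ⟨⟨c, hc, fun d hd => ?_⟩, h₃, h₄, h₅ h₀⟩
    by_contra hcd
    exact h₆ c hc (hmid' c d hd hcd)
  · rintro ⟨⟨c, hc, hu⟩, h₃, h₄, h₅⟩
    refine ⟨h₃, h₄, fun _ => h₅, fun d hd => ?_, fun _ => h₅⟩
    rw [hmid d fun d' hd' => (hu d' hd').trans (hu d hd).symm]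
    exact h₅

/-- A second parallel edge still joins the new vertices, so acyclicity at the middle edges means
there is only one. The separation hypothesis gives the converse. -/
lemma existsUnique_and_iff_of_separated {P : Prop} (h₁ : ∃ c, G.middleEdge e c ∈ S)
    (hs : ∀ c, (∀ d, G.middleEdge e d ∈ S → d = c) →
      ¬ (G.bananify131 e).Joined (S \ {G.middleEdge e c}) (G.newVertex e 0) (G.newVertex e 1)) :
    (P ∧ ∀ c, G.middleEdge e c ∈ S → ¬ (G.bananify131 e).Joined (S \ {G.middleEdge e c})
      (G.newVertex e 0) (G.newVertex e 1)) ↔ (∃! c, G.middleEdge e c ∈ S) ∧ P := by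
  rw [and_comm]
  refine and_congr_left fun _ => ⟨fun h => ?_, ?_⟩
  · obtain ⟨c, hc⟩ := h₁
    refine ⟨c, hc, fun d hd => by_contra fun hcd => h c hc ?_⟩
    exact Joined.of_mem (f := G.middleEdge e d) ⟨hd, fun h => hcd (middleEdge_injective h)⟩
  · rintro ⟨c, hc, hu⟩ d hd
    exact hs d fun d' hd' => (hu d' hd').trans (hu d hd).symm

variable (S) in
lemma isSpanningTree_bananify131_of_first_middle (h₀ : G.firstEdge e ∈ S)
    (h₁ : ∃ c, G.middleEdge e c ∈ S) (h₂ : G.lastEdge e ∉ S) :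
    (G.bananify131 e).IsSpanningTree S ↔
      (∃! c, G.middleEdge e c ∈ S) ∧ G.IsSpanningTree (oldEdges S) := by
  have hold (f) : (G.bananify131 e).Joined (S \ {G.oldEdge e f}) (G.oldVertex e (G.src f))
      (G.oldVertex e (G.tgt f)) ↔
        G.Joined (oldEdges S \ {f.val}) (G.src f) (G.tgt f) := by
    rw [joined_iff_of_first_middle (by simpa) (by simpa) (by simp [h₂]), oldEdges_diff_oldEdge]
    simp
  have hfirst : ¬ (G.bananify131 e).Joined (S \ {G.firstEdge e}) (G.oldVertex e (G.src e))
      (G.newVertex e 0) :=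
    not_joined_oldVertex_newVertex (by simp) (by simp [h₂]) _ _
  rw [isSpanningTree_bananify131_iff_forall, isSpanningTree_oldEdges_iff,
    ← existsUnique_and_iff_of_separated h₁ fun c hc => not_joined_newVertex_one
      (fun d hd => hd.2 (by rw [hc d hd.1]; rfl)) (by simp [h₂]) (newVertex_injective.ne (by decide))]
  simp only [joined_iff_of_first_middle h₀ h₁ h₂, hold, hfirst]
  rw [forall_retract_iff _ _ (G.Joined _)]
  tauto

variable (S) in
lemma isSpanningTree_bananify131_of_middle_last (h₀ : G.firstEdge e ∉ S)
    (h₁ : ∃ c, G.middleEdge e c ∈ S) (h₂ : G.lastEdge e ∈ S) :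
    (G.bananify131 e).IsSpanningTree S ↔
      (∃! c, G.middleEdge e c ∈ S) ∧ G.IsSpanningTree (oldEdges S) := by
  have hold (f) : (G.bananify131 e).Joined (S \ {G.oldEdge e f}) (G.oldVertex e (G.src f))
      (G.oldVertex e (G.tgt f)) ↔
        G.Joined (oldEdges S \ {f.val}) (G.src f) (G.tgt f) := by
    rw [joined_iff_of_middle_last (by simp [h₀]) (by simpa) (by simpa), oldEdges_diff_oldEdge]
    simp
  have hlast : ¬ (G.bananify131 e).Joined (S \ {G.lastEdge e}) (G.newVertex e 1)
      (G.oldVertex e (G.tgt e)) := fun h =>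
    not_joined_oldVertex_newVertex (by simp [h₀]) (by simp) _ _ h.symm
  rw [isSpanningTree_bananify131_iff_forall, isSpanningTree_oldEdges_iff,
    ← existsUnique_and_iff_of_separated h₁ fun c hc h => not_joined_newVertex_zero (by simp [h₀])
      (fun d hd => hd.2 (by rw [hc d hd.1]; rfl)) (newVertex_injective.ne (by decide)) h.symm]
  simp only [joined_iff_of_middle_last h₀ h₁ h₂, hold, hlast]
  rw [forall_retract_iff _ _ (G.Joined _)]
  tauto

-- Both remaining edges are pendant, hence bridges: removing one isolates its new vertex.
variable (S) in
lemma isSpanningTree_bananify131_of_first_last (h₀ : G.firstEdge e ∈ S)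
    (h₁ : ∀ c, G.middleEdge e c ∉ S) (h₂ : G.lastEdge e ∈ S) :
    (G.bananify131 e).IsSpanningTree S ↔ G.IsSpanningTree (oldEdges S) := by
  have hold (f) : (G.bananify131 e).Joined (S \ {G.oldEdge e f}) (G.oldVertex e (G.src f))
      (G.oldVertex e (G.tgt f)) ↔
        G.Joined (oldEdges S \ {f.val}) (G.src f) (G.tgt f) := by
    rw [joined_iff_of_first_last (by simpa) (by simp [h₁]) (by simpa), oldEdges_diff_oldEdge]
    simp
  have hfirst : ¬ (G.bananify131 e).Joined (S \ {G.firstEdge e}) (G.oldVertex e (G.src e))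
      (G.newVertex e 0) :=
    not_joined_newVertex_zero (by simp) (by simp [h₁]) (oldVertex_ne_newVertex _ _)
  have hlast : ¬ (G.bananify131 e).Joined (S \ {G.lastEdge e}) (G.newVertex e 1)
      (G.oldVertex e (G.tgt e)) := fun h =>
    not_joined_newVertex_one (by simp [h₁]) (by simp) (oldVertex_ne_newVertex _ _) h.symm
  rw [isSpanningTree_bananify131_iff_forall, isSpanningTree_oldEdges_iff]
  simp only [joined_iff_of_first_last h₀ h₁ h₂, hold, hfirst, hlast, h₁]
  rw [forall_retract_iff _ _ (G.Joined _)]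
  tauto

open Classical in
/-- The spanning trees of a `(1,3,1)`-bananification. -/
lemma isSpanningTree_bananify131_iff : (G.bananify131 e).IsSpanningTree S ↔
    if G.firstEdge e ∈ S ∧ G.lastEdge e ∈ S ∧ ∃! c, G.middleEdge e c ∈ S then
      G.IsSpanningTree (insert e (oldEdges S))
    else ((G.firstEdge e ∈ S ∧ G.lastEdge e ∈ S ∧ ∀ c, G.middleEdge e c ∉ S) ∨
      (¬ (G.firstEdge e ∈ S ↔ G.lastEdge e ∈ S) ∧ ∃! c, G.middleEdge e c ∈ S)) ∧
        G.IsSpanningTree (oldEdges S) := by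
  -- Two missing bananas cut off a new vertex, or both of them together, so `S` cannot be connected.
  have hn₀ (h₀ : G.firstEdge e ∉ S) (h₁ : ∀ c, G.middleEdge e c ∉ S) :
      ¬ (G.bananify131 e).IsSpanningTree S := fun h =>
    not_joined_newVertex_zero h₀ h₁ (oldVertex_ne_newVertex (G.src e) 0) (h.2.1 _ _)
  have hn₁ (h₁ : ∀ c, G.middleEdge e c ∉ S) (h₂ : G.lastEdge e ∉ S) :
      ¬ (G.bananify131 e).IsSpanningTree S := fun h =>
    not_joined_newVertex_one h₁ h₂ (oldVertex_ne_newVertex (G.src e) 1) (h.2.1 _ _)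
  have hn₂ (h₀ : G.firstEdge e ∉ S) (h₂ : G.lastEdge e ∉ S) :
      ¬ (G.bananify131 e).IsSpanningTree S := fun h =>
    not_joined_oldVertex_newVertex h₀ h₂ (G.src e) 0 (h.2.1 _ _)
  by_cases h₁ : ∃ c, G.middleEdge e c ∈ S
  · have h₁' : ¬ ∀ c, G.middleEdge e c ∉ S := by simpa using h₁
    by_cases h₀ : G.firstEdge e ∈ S <;> by_cases h₂ : G.lastEdge e ∈ S
    · rw [isSpanningTree_bananify131_of_first_middle_last S h₀ h₁ h₂]
      simp [h₀, h₂, h₁']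
    · rw [isSpanningTree_bananify131_of_first_middle S h₀ h₁ h₂]
      simp [h₀, h₂]
    · rw [isSpanningTree_bananify131_of_middle_last S h₀ h₁ h₂]
      simp [h₀, h₂]
    · simp [h₀, h₂, hn₂ h₀ h₂]
  · have h₁' : ∀ c, G.middleEdge e c ∉ S := by simpa using h₁
    have h₁'' : ¬ ∃! c, G.middleEdge e c ∈ S := fun ⟨c, hc, _⟩ => h₁' c hc
    by_cases h₀ : G.firstEdge e ∈ S <;> by_cases h₂ : G.lastEdge e ∈ S
    · rw [isSpanningTree_bananify131_of_first_last S h₀ h₁' h₂]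
      simp [h₀, h₂, h₁']
    · simp [h₂, h₁'', hn₁ h₁' h₂]
    · simp [h₀, h₁'', hn₀ h₀ h₁']
    · simp [h₀, h₂, hn₀ h₀ h₁']

end SpanningTrees

end Multigraph

/-! ### Kirchhoff polynomials and deletion-contraction -/

namespace Multigraph

section Kirchhoff

open MvPolynomial

variable (G : Multigraph) (e : G.E) (K : Type u) [Field K]

open Classical in
/-- Sets correspond to their indicator functions. -/
noncomputable def setEquivIndicator {α : Type} : Set α ≃ (α → Bool) where
  toFun S f := decide (f ∈ S)
  invFun x := {f | x f}
  left_inv S := by simp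
  right_inv x := by simp

/-- The monomial of the complement of a set of edges, given by its indicator function. -/
noncomputable def complMonomial {σ : Type} [Fintype σ] (x : σ → Bool) : MvPolynomial σ K :=
  ∏ f, if x f then 1 else X f

-- Indicator functions turn the sum over trees into one over a product type, which can be split
-- along a partition of the edges.
open Classical in
lemma kirchhoff_eq_sum [Fintype G.E] : G.kirchhoff K =
    ∑ x : G.E → Bool, if G.IsSpanningTree {f | x f} then complMonomial K x else 0 := by
  have h : G.kirchhoff K = ∑ᶠ S : Set G.E,
      if G.IsSpanningTree S then ∏ f, (if f ∈ S then 1 else X f) else 0 := by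
    refine finsum_congr fun S => ?_
    rw [finsum_eq_if]
    refine if_congr Iff.rfl ?_ rfl
    rw [finprod_eq_prod_of_fintype]
    refine Finset.prod_congr rfl fun f _ => ?_
    rw [finprod_eq_if]
    by_cases hf : f ∈ S <;> simp [hf]
  rw [h, finsum_eq_sum_of_fintype]
  refine Fintype.sum_equiv setEquivIndicator _ _ fun S => ?_
  have hS : {f | setEquivIndicator S f = true} = S := setEquivIndicator.left_inv S
  rw [hS, complMonomial]
  refine if_congr Iff.rfl (Finset.prod_congr rfl fun f _ => ?_) rfl
  exact if_congr (by simp [setEquivIndicator]) rfl rfl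

open Classical in
/-- The coefficient of the variable of `e` in the Kirchhoff polynomial. -/
noncomputable def coeffOne : MvPolynomial {x : G.E // x ≠ e} K :=
  letI := Fintype.ofFinite {x : G.E // x ≠ e}
  ∑ x : {x : G.E // x ≠ e} → Bool,
    if G.IsSpanningTree (Subtype.val '' {f | x f}) then complMonomial K x else 0

open Classical in
/-- The part of the Kirchhoff polynomial without the variable of `e`. -/
noncomputable def coeffZero : MvPolynomial {x : G.E // x ≠ e} K :=
  letI := Fintype.ofFinite {x : G.E // x ≠ e}
  ∑ x : {x : G.E // x ≠ e} → Bool,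
    if G.IsSpanningTree (insert e (Subtype.val '' {f | x f})) then complMonomial K x else 0

lemma rename_complMonomial {σ τ : Type} [Fintype σ] (x : σ → Bool) (g : σ → τ) :
    rename g (complMonomial K x) = ∏ f, if x f then 1 else X (g f) := by
  rw [complMonomial, map_prod]
  refine Finset.prod_congr rfl fun f _ => ?_
  split_ifs <;> simp

lemma kirchhoff_eq_coeff : G.kirchhoff K =
    X e * rename Subtype.val (G.coeffOne e K) + rename Subtype.val (G.coeffZero e K) := by
  classical
  let := Fintype.ofFinite {x : G.E // x ≠ e}
  let := Fintype.ofFinite G.E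
  rw [kirchhoff_eq_sum, ← (Equiv.funSplitAt e Bool).symm.sum_comp, Fintype.sum_prod_type,
    Fintype.sum_bool, add_comm, coeffOne, coeffZero, map_sum, map_sum, Finset.mul_sum]
  have hprod (b : Bool) (x : {x : G.E // x ≠ e} → Bool) :
      complMonomial K ((Equiv.funSplitAt e Bool).symm (b, x)) =
        (if b then 1 else X e) * rename Subtype.val (complMonomial K x) := by
    rw [rename_complMonomial, complMonomial, Fintype.prod_eq_mul_prod_subtype_ne _ e]
    congr 1
    · simp [Equiv.funSplitAt, Equiv.piSplitAt]
    · refine Finset.prod_congr (Finset.ext fun _ => by simp) fun f _ => ?_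
      simp [Equiv.funSplitAt, Equiv.piSplitAt, f.2]
  congr 1 <;> refine Finset.sum_congr rfl fun x _ => ?_
  · have : {f | (Equiv.funSplitAt e Bool).symm (false, x) f = true} =
        Subtype.val '' {f | x f = true} := by
      ext f
      by_cases hf : f = e <;> simp [Equiv.funSplitAt, Equiv.piSplitAt, hf]
    rw [hprod, this]
    split_ifs <;> simp_all
  · have : {f | (Equiv.funSplitAt e Bool).symm (true, x) f = true} =
        insert e (Subtype.val '' {f | x f = true}) := by
      ext f
      by_cases hf : f = e <;> simp [Equiv.funSplitAt, Equiv.piSplitAt, hf]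
    rw [hprod, this]
    split_ifs <;> simp_all

/-- Indicator functions of sets of edges of a bananification. -/
def bananaIndicator (x : {x : G.E // x ≠ e} → Bool) (a m₀ m₁ m₂ b : Bool) :
    (G.bananify131 e).E → Bool :=
  Sum.elim x fun p => match p with
    | ⟨0, _⟩ => a
    | ⟨1, c⟩ => ![m₀, m₁, m₂] c
    | ⟨2, _⟩ => b

variable {G e}

@[simp] lemma bananaIndicator_firstEdge (x a m₀ m₁ m₂ b) :
    G.bananaIndicator e x a m₀ m₁ m₂ b (G.firstEdge e) = a := rfl
@[simp] lemma bananaIndicator_middleEdge (x a m₀ m₁ m₂ b c) :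
    G.bananaIndicator e x a m₀ m₁ m₂ b (G.middleEdge e c) = ![m₀, m₁, m₂] c := rfl
@[simp] lemma bananaIndicator_lastEdge (x a m₀ m₁ m₂ b) :
    G.bananaIndicator e x a m₀ m₁ m₂ b (G.lastEdge e) = b := rfl

variable (G e) in
/-- Indicator functions of sets of edges of a bananification, as tuples. -/
def bananaIndicatorEquiv :
    ({x : G.E // x ≠ e} → Bool) × Bool × Bool × Bool × Bool × Bool ≃
      ((G.bananify131 e).E → Bool) where
  toFun t := G.bananaIndicator e t.1 t.2.1 t.2.2.1 t.2.2.2.1 t.2.2.2.2.1 t.2.2.2.2.2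
  invFun y := (fun f => y (G.oldEdge e f), y (G.firstEdge e), y (G.middleEdge e 0),
    y (G.middleEdge e 1), y (G.middleEdge e 2), y (G.lastEdge e))
  left_inv _ := rfl
  right_inv y := by
    funext f
    revert f
    refine bananify131_edge_cases (fun _ => rfl) rfl (fun c => ?_) rfl
    fin_cases c <;> rfl

lemma prod_bananify131_edges {M : Type*} [CommMonoid M] [Fintype {x : G.E // x ≠ e}]
    [Fintype (G.bananify131 e).E] (g : (G.bananify131 e).E → M) :
    ∏ f, g f = (∏ f, g (G.oldEdge e f)) * (g (G.firstEdge e) * (g (G.middleEdge e 0) *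
      g (G.middleEdge e 1) * g (G.middleEdge e 2)) * g (G.lastEdge e)) := by
  let E : {x : G.E // x ≠ e} ⊕ (Σ i : Fin 3, Fin (![1, 3, 1] i)) ≃ (G.bananify131 e).E :=
    Equiv.refl _
  rw [← E.prod_comp, Fintype.prod_sum_type]
  congr 1
  rw [Fintype.prod_sigma, Fin.prod_univ_three]
  congr 1
  · congr 1
    · exact Fin.prod_univ_one (fun c => g (Sum.inr ⟨0, c⟩))
    · exact Fin.prod_univ_three (fun c => g (G.middleEdge e c))
  · exact Fin.prod_univ_one (fun c => g (Sum.inr ⟨2, c⟩))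

/-- The conditions on the five new edges become Boolean expressions, so that the sum over them can
be evaluated by cases. -/
lemma isSpanningTree_bananaIndicator_iff (x a m₀ m₁ m₂ b) :
    (G.bananify131 e).IsSpanningTree {f | G.bananaIndicator e x a m₀ m₁ m₂ b f} ↔
    if a && b && (m₀ && !m₁ && !m₂ || !m₀ && m₁ && !m₂ || !m₀ && !m₁ && m₂) then
      G.IsSpanningTree (insert e (Subtype.val '' {f | x f}))
    else (a && b && (!m₀ && !m₁ && !m₂) ||
      (a != b) && (m₀ && !m₁ && !m₂ || !m₀ && m₁ && !m₂ || !m₀ && !m₁ && m₂)) ∧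
        G.IsSpanningTree (Subtype.val '' {f | x f}) := by
  have huniq : (∃! c : Fin 3, ![m₀, m₁, m₂] c = true) ↔
      (m₀ && !m₁ && !m₂ || !m₀ && m₁ && !m₂ || !m₀ && !m₁ && m₂) = true := by
    unfold ExistsUnique
    revert m₀ m₁ m₂
    decide
  have hnone : (∀ c : Fin 3, ¬ ![m₀, m₁, m₂] c = true) ↔
      (!m₀ && !m₁ && !m₂) = true := by
    clear huniq
    revert m₀ m₁ m₂
    decide
  rw [isSpanningTree_bananify131_iff, show oldEdges _ = Subtype.val '' {f | x f = true} from rfl]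
  simp only [Set.mem_ofPred_eq, bananaIndicator_firstEdge, bananaIndicator_lastEdge,
    bananaIndicator_middleEdge, huniq, hnone]
  refine iff_of_eq (if_congr ?_ rfl (propext (and_congr_left fun _ => ?_)))
  all_goals
    clear huniq hnone
    revert a b m₀ m₁ m₂
    decide

/-- Each factor `t_i t_j` comes from keeping one parallel edge, `t₀ t₁ t₂` from keeping none; `s` or
`t` records an omitted outer edge. -/
lemma sum_gadget {M : Type*} [CommRing M] (P Q : Prop) [Decidable P] [Decidable Q]
    (w s t₀ t₁ t₂ t : M) :
    (∑ a : Bool, ∑ m₀ : Bool, ∑ m₁ : Bool, ∑ m₂ : Bool, ∑ b : Bool,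
      if (if a && b && (m₀ && !m₁ && !m₂ || !m₀ && m₁ && !m₂ || !m₀ && !m₁ && m₂) then P
        else (a && b && (!m₀ && !m₁ && !m₂) ||
          (a != b) && (m₀ && !m₁ && !m₂ || !m₀ && m₁ && !m₂ || !m₀ && !m₁ && m₂)) ∧ Q)
      then w * ((if a then 1 else s) * ((if m₀ then 1 else t₀) * (if m₁ then 1 else t₁) *
        (if m₂ then 1 else t₂)) * (if b then 1 else t)) else 0) =
    (t₀ * t₁ + t₀ * t₂ + t₁ * t₂) * ((s + t) * (if Q then w else 0) + if P then w else 0) +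
      t₀ * t₁ * t₂ * (if Q then w else 0) := by
  by_cases hP : P <;> by_cases hQ : Q <;> simp [hP, hQ] <;> ring

lemma kirchhoff_bananify131 : (G.bananify131 e).kirchhoff K =
    (X (G.middleEdge e 0) * X (G.middleEdge e 1) + X (G.middleEdge e 0) * X (G.middleEdge e 2) +
        X (G.middleEdge e 1) * X (G.middleEdge e 2)) *
      ((X (G.firstEdge e) + X (G.lastEdge e)) * rename (G.oldEdge e) (G.coeffOne e K) +
        rename (G.oldEdge e) (G.coeffZero e K)) +
    X (G.middleEdge e 0) * X (G.middleEdge e 1) * X (G.middleEdge e 2) *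
      rename (G.oldEdge e) (G.coeffOne e K) := by
  classical
  let := Fintype.ofFinite {x : G.E // x ≠ e}
  let := Fintype.ofFinite (G.bananify131 e).E
  rw [kirchhoff_eq_sum, ← (bananaIndicatorEquiv G e).sum_comp]
  have hprod (x a m₀ m₁ m₂ b) : complMonomial K (G.bananaIndicator e x a m₀ m₁ m₂ b) =
      rename (G.oldEdge e) (complMonomial K x) * ((if a then 1 else X (G.firstEdge e)) *
        ((if m₀ then 1 else X (G.middleEdge e 0)) * (if m₁ then 1 else X (G.middleEdge e 1)) *
        (if m₂ then 1 else X (G.middleEdge e 2))) * (if b then 1 else X (G.lastEdge e))) := by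
    rw [rename_complMonomial, complMonomial, prod_bananify131_edges]
    rfl
  simp only [Fintype.sum_prod_type]
  rw [coeffOne, coeffZero, map_sum, map_sum]
  simp only [Finset.mul_sum, ← Finset.sum_add_distrib]
  refine Finset.sum_congr rfl fun x _ => ?_
  simp only [apply_ite (rename (G.oldEdge e)), map_zero]
  rw [← sum_gadget]
  refine Fintype.sum_congr _ _ fun a => Fintype.sum_congr _ _ fun m₀ => Fintype.sum_congr _ _
    fun m₁ => Fintype.sum_congr _ _ fun m₂ => Fintype.sum_congr _ _ fun b => ?_
  exact if_congr (isSpanningTree_bananaIndicator_iff x a m₀ m₁ m₂ b) (hprod x a m₀ m₁ m₂ b) rfl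

end Kirchhoff

end Multigraph

/-! ### The recursion applied to graphs -/

namespace Multigraph

section Classes

open MvPolynomial

variable (G : Multigraph) (e : G.E) (K : Type u) [Field K]

lemma grothendieckClass_eq : G.grothendieckClass K =
    torusClass K * locusClass K ∅ (G.coeffOne e K) +
      (torusClass K + 1) * locusClass K {G.coeffOne e K} (G.coeffZero e K) := by
  classical
  rw [← locusClass_linear, locusClass_congr_algEquiv (renameEquiv K (Equiv.optionSubtypeNe e)),
    grothendieckClass, varietyClass_hypersurfaceComplement_eq_locusClass, Set.image_empty,
    kirchhoff_eq_coeff G e]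
  simp only [map_add, map_mul, renameEquiv_apply, rename_rename, rename_X,
    Equiv.optionSubtypeNe_none]
  rw [mul_comm]
  rfl

-- Substituting `0` and `1` for the variable of `e` recovers `B` and `A + B`.
variable {G e K} in
lemma eq_and_eq_of_linear_eq {A B A' B' : MvPolynomial {x : G.E // x ≠ e} K}
    (h : X e * rename Subtype.val A + rename Subtype.val B =
      X e * rename Subtype.val A' + rename Subtype.val B') : A = A' ∧ B = B' := by
  classical
  have key (v : MvPolynomial {x : G.E // x ≠ e} K) : v * A + B = v * A' + B' := by
    have := congrArg (aeval fun x => if hx : x = e then v else X ⟨x, hx⟩) h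
    have hid : (fun x => if hx : x = e then v else X ⟨x, hx⟩) ∘
        (Subtype.val : {x : G.E // x ≠ e} → G.E) = X := by
      funext x
      simp [x.2]
    simpa only [map_add, map_mul, aeval_rename, hid, aeval_X, dite_true, aeval_X_left_apply]
      using this
  have h₀ := key 0
  have h₁ := key 1
  simp only [zero_mul, zero_add, one_mul] at h₀ h₁
  exact ⟨by simpa [h₀] using h₁, h₀⟩

variable {G e}

/-- The edges of a bananification other than the one marked, ordered. -/
def unmarkedEdge (c : Fin 3) : Option (Option (Option (Option {x : G.E // x ≠ e}))) →
    {x : (G.bananify131 e).E // x ≠ G.middleEdge e c}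
  | none => ⟨G.firstEdge e, firstEdge_ne_middleEdge c⟩
  | some none => ⟨G.lastEdge e, lastEdge_ne_middleEdge c⟩
  | some (some none) => ⟨G.middleEdge e (c + 1), middleEdge_injective.ne (by revert c; decide)⟩
  | some (some (some none)) =>
    ⟨G.middleEdge e (c + 2), middleEdge_injective.ne (by revert c; decide)⟩
  | some (some (some (some f))) => ⟨G.oldEdge e f, (middleEdge_ne_oldEdge c f).symm⟩

lemma unmarkedEdge_bijective (c : Fin 3) :
    Function.Bijective (unmarkedEdge (G := G) (e := e) c) := by
  have hc : c + 1 ≠ c + 2 := by revert c; decide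
  have hold (f g : {x : G.E // x ≠ e}) : G.oldEdge e f = G.oldEdge e g ↔ f = g :=
    Sum.inl_injective.eq_iff
  constructor
  · rintro (_ | _ | _ | _ | f) (_ | _ | _ | _ | g) h <;>
      first
      | rfl
      | exact congrArg (fun x => some (some (some (some x)))) ((hold f g).mp (congrArg Subtype.val h))
      | exact absurd h (by simp [unmarkedEdge, middleEdge_injective.eq_iff, hc, hc.symm])
  · rintro ⟨f, hf⟩
    revert f
    refine bananify131_edge_cases (fun f _ => ⟨some (some (some (some f))), rfl⟩)
      (fun _ => ⟨none, rfl⟩) (fun d hd => ?_) (fun _ => ⟨some none, rfl⟩)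
    have hd' : d = c + 1 ∨ d = c + 2 := by
      have : d ≠ c := fun h => hd (congrArg _ h)
      clear hd hc hold
      revert c d
      decide
    rcases hd' with rfl | rfl
    · exact ⟨some (some none), rfl⟩
    · exact ⟨some (some (some none)), rfl⟩

variable (G e) in
/-- Numbering of the edges of a bananification other than the one marked. -/
noncomputable def unmarkedEquiv (c : Fin 3) :
    Option (Option (Option (Option {x : G.E // x ≠ e}))) ≃
      {x : (G.bananify131 e).E // x ≠ G.middleEdge e c} :=
  Equiv.ofBijective _ (unmarkedEdge_bijective c)

/-- Both sides decompose the same polynomial linearly in the marked variable, and such a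
decomposition is unique. -/
lemma coeff_bananify131 (c : Fin 3) :
    (G.bananify131 e).coeffOne (G.middleEdge e c) K = renameEquiv K (unmarkedEquiv G e c)
      (bananaCoeffOne (X none) (X (some none)) (rename some (rename some (G.coeffOne e K)))
        (rename some (rename some (G.coeffZero e K)))) ∧
    (G.bananify131 e).coeffZero (G.middleEdge e c) K = renameEquiv K (unmarkedEquiv G e c)
      (bananaCoeffZero (X none) (X (some none)) (rename some (rename some (G.coeffOne e K)))
        (rename some (rename some (G.coeffZero e K)))) := by
  refine eq_and_eq_of_linear_eq ?_
  rw [← kirchhoff_eq_coeff, kirchhoff_bananify131]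
  have h₀ : ((unmarkedEquiv G e c) none).val = G.firstEdge e := rfl
  have h₁ : ((unmarkedEquiv G e c) (some none)).val = G.lastEdge e := rfl
  have h₂ : ((unmarkedEquiv G e c) (some (some none))).val = G.middleEdge e (c + 1) := rfl
  have h₃ : ((unmarkedEquiv G e c) (some (some (some none)))).val = G.middleEdge e (c + 2) := rfl
  have h₄ : ∀ (p : MvPolynomial {x : G.E // x ≠ e} K),
      rename (fun f => ((unmarkedEquiv G e c) (some (some (some (some f))))).val) p =
        rename (G.oldEdge e) p := fun p => rfl
  simp only [bananaCoeffOne, bananaCoeffZero, map_add, map_mul, renameEquiv_apply, rename_rename,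
    rename_X, Function.comp_def, h₀, h₁, h₂, h₃, h₄]
  -- The formula is symmetric in the three parallel edges; only the cyclic indices `c + 1`, `c + 2`
  -- need evaluating.
  fin_cases c
  · simp only [Fin.zero_eta, zero_add]
    ring
  · simp only [Fin.mk_one, show (1 : Fin 3) + 1 = 2 from rfl, show (1 : Fin 3) + 2 = 0 from rfl]
    ring
  · simp only [Fin.reduceFinMk, show (2 : Fin 3) + 1 = 0 from rfl,
      show (2 : Fin 3) + 2 = 1 from rfl]
    ring

lemma locusClass_coeffOne_bananify131 (c : Fin 3) :
    locusClass K ∅ ((G.bananify131 e).coeffOne (G.middleEdge e c) K) =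
      torusClass K * (torusClass K + 1) ^ 3 * (locusClass K ∅ (G.coeffOne e K) +
        locusClass K {G.coeffOne e K} (G.coeffZero e K)) := by
  rw [(coeff_bananify131 K c).1, ← locusClass_bananification_coeffOne,
    locusClass_congr_algEquiv (renameEquiv K (unmarkedEquiv G e c)), Set.image_empty]

lemma locusClass_coeffZero_bananify131 (c : Fin 3) :
    locusClass K {(G.bananify131 e).coeffOne (G.middleEdge e c) K}
      ((G.bananify131 e).coeffZero (G.middleEdge e c) K) =
      torusClass K * (torusClass K - 1) * (torusClass K + 1) *
          locusClass K ∅ (G.coeffOne e K) +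
        torusClass K * (torusClass K + 1) ^ 2 *
          locusClass K {G.coeffOne e K} (G.coeffZero e K) := by
  rw [(coeff_bananify131 K c).1, (coeff_bananify131 K c).2, ← locusClass_bananification_coeffZero,
    locusClass_congr_algEquiv (renameEquiv K (unmarkedEquiv G e c)) {_}, Set.image_singleton]

instance : IsEmpty {x : singleEdge.E // x ≠ ()} := ⟨fun x => x.2 rfl⟩

/-- Without its edge the graph is disconnected, so no spanning tree avoids it. -/
lemma coeffOne_singleEdge : singleEdge.coeffOne () K = 0 := by
  classical
  refine Finset.sum_eq_zero fun x _ => if_neg fun h => ?_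
  have hS : (Subtype.val '' {f : {x : singleEdge.E // x ≠ ()} | x f = true}) = ∅ := by
    rw [Set.image_eq_empty]
    exact Set.eq_empty_of_isEmpty _
  rw [hS] at h
  have := Joined.apply_eq (id : Bool → Bool) (fun f hf => hf.elim) (h.2.1 false true)
  exact absurd this (by decide)

lemma coeffZero_singleEdge : singleEdge.coeffZero () K = 1 := by
  classical
  have hS (x : {x : singleEdge.E // x ≠ ()} → Bool) :
      (insert () (Subtype.val '' {f : {x : singleEdge.E // x ≠ ()} | x f = true})) =
        (Set.univ : Set singleEdge.E) :=
    Set.eq_univ_of_forall fun _ => Set.mem_insert _ _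
  have hT (T : Set singleEdge.E) (hT : T = Set.univ) : singleEdge.IsSpanningTree T := by
    subst hT
    have h : singleEdge.Joined Set.univ false true := Joined.of_mem (f := ()) (Set.mem_univ _)
    refine ⟨⟨false⟩, ?_, fun f _ h => ?_⟩
    · rintro (_ | _) (_ | _)
      · exact .refl _ _
      · exact h
      · exact h.symm
      · exact .refl _ _
    · have := Joined.apply_eq (id : Bool → Bool) (fun g hg => (hg.2 rfl).elim) h
      exact Bool.false_ne_true this
  unfold coeffZero
  simp only [Fintype.sum_unique, complMonomial, Finset.univ_eq_empty, Finset.prod_empty]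
  exact if_pos (hT _ (hS _))

lemma locusClass_coeffOne_singleEdge : locusClass K ∅ (singleEdge.coeffOne () K) = 0 := by
  rw [coeffOne_singleEdge]
  exact locusClass_eq_zero fun F _ φ h => h.2 (map_zero φ)

/-- No variables remain and the conditions are `0 = 0` and `1 ≠ 0`: the locus is a point. -/
lemma locusClass_coeffZero_singleEdge :
    locusClass K {singleEdge.coeffOne () K} (singleEdge.coeffZero () K) = 1 := by
  rw [coeffOne_singleEdge, coeffZero_singleEdge,
    locusClass_congr_algEquiv (isEmptyAlgEquiv K {x : singleEdge.E // x ≠ ()}), ← locusClass_field_one K]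
  refine locusClass_congr (Set.toFinite _) (Set.toFinite _) fun F _ φ => ?_
  simp [IsPointOf]

end Classes

end Multigraph

variable (K : Type u) [Field K]

/-- The classes governing the recursion for `Γ_n`, in terms of two sequences. -/
lemma locusClass_coeff_markedGamma (c : ℕ → Fin 3) (p q : ℕ → GrothendieckRing K) (hp₀ : p 0 = 0)
    (hq₀ : q 0 = 1) (hp : ∀ n, p (n + 1) = (torusClass K + 1) * p n + q n)
    (hq : ∀ n, q (n + 1) = (torusClass K - 1) * p n + q n) (n : ℕ) :
    locusClass K ∅ ((markedGamma c n).1.coeffOne (markedGamma c n).2 K) =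
        torusClass K ^ n * (torusClass K + 1) ^ (2 * n + 1) * p n ∧
      locusClass K {(markedGamma c n).1.coeffOne (markedGamma c n).2 K}
        ((markedGamma c n).1.coeffZero (markedGamma c n).2 K) =
        torusClass K ^ n * (torusClass K + 1) ^ (2 * n) * q n := by
  induction n with
  | zero =>
    simp only [hp₀, hq₀, pow_zero, mul_zero, mul_one]
    exact ⟨Multigraph.locusClass_coeffOne_singleEdge K,
      Multigraph.locusClass_coeffZero_singleEdge K⟩
  | succ n ih =>
    have h₁ := Multigraph.locusClass_coeffOne_bananify131 (e := (markedGamma c n).2) K (c n)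
    have h₂ := Multigraph.locusClass_coeffZero_bananify131 (e := (markedGamma c n).2) K (c n)
    rw [ih.1, ih.2] at h₁ h₂
    refine ⟨h₁.trans ?_, h₂.trans ?_⟩
    · rw [hp]
      ring
    · rw [hq]
      ring

/-! ### The polynomials `a_k` and `A_n` -/

section Expansion

open Polynomial

/-- The polynomials `a_k` in the expansion of `e^{rs} cos((r² - rt)^{1/2} s)`. -/
noncomputable def expCosCoeff : ℕ → ℤ[X][X]
  | 0 => 1
  | 1 => X
  | k + 2 => X * (2 * expCosCoeff (k + 1) - 2 * (X * expCosCoeff k) + C X * expCosCoeff k)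

/-- The numbers `r ± iτ` have sum `2r` and product `2r² - rt`, so their power sums obey the defining
recurrence. -/
lemma aevalAeval_expCosCoeff {r t τ : ℂ} (h : τ ^ 2 = r ^ 2 - r * t) (k : ℕ) :
    aevalAeval t r (expCosCoeff k) =
      ((r + τ * Complex.I) ^ k + (r - τ * Complex.I) ^ k) / 2 := by
  induction k using Nat.twoStepInduction with
  | zero => simp [expCosCoeff]
  | one => simp [expCosCoeff]
  | more k ih₁ ih₂ =>
    rw [expCosCoeff]
    simp only [map_mul, map_add, map_sub, aevalAeval_Y, aevalAeval_X, ih₁, ih₂, map_ofNat]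
    have hI := Complex.I_sq
    set u := r + τ * Complex.I with hu
    set v := r - τ * Complex.I with hv
    have hs : u + v = 2 * r := by rw [hu, hv]; ring
    have hp : u * v = 2 * r ^ 2 - r * t := by
      rw [hu, hv]
      linear_combination h - τ ^ 2 * hI
    rw [pow_succ, pow_succ, pow_succ _ (k + 1), pow_succ _ k, pow_succ, pow_succ v k]
    linear_combination (-(u ^ k * u + v ^ k * v) / 2) * hs + ((u ^ k + v ^ k) / 2) * hp

lemma isExpCosExpansion_expCosCoeff : IsExpCosExpansion expCosCoeff := by
  intro r t τ s h
  have h₁ := NormedSpace.expSeries_div_hasSum_exp ((r + τ * Complex.I) * s)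
  have h₂ := NormedSpace.expSeries_div_hasSum_exp ((r - τ * Complex.I) * s)
  rw [← Complex.exp_eq_exp_ℂ] at h₁ h₂
  have h₃ := (h₁.add h₂).div_const 2
  have he : (Complex.exp ((r + τ * Complex.I) * s) + Complex.exp ((r - τ * Complex.I) * s)) / 2 =
      Complex.exp (r * s) * Complex.cos (τ * s) := by
    rw [Complex.cos, mul_div_assoc', mul_add, ← Complex.exp_add, ← Complex.exp_add]
    congr 3 <;> ring
  rw [he] at h₃
  refine h₃.congr_fun fun k => ?_
  rw [aevalAeval_expCosCoeff h, mul_pow, mul_pow]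
  ring

lemma coeff_eq_of_hasSum {c d : ℕ → ℂ} {f : ℂ → ℂ}
    (hc : ∀ s, HasSum (fun k => c k * s ^ k / (k.factorial : ℂ)) (f s))
    (hd : ∀ s, HasSum (fun k => d k * s ^ k / (k.factorial : ℂ)) (f s)) : c = d := by
  have key {c : ℕ → ℂ} (hc : ∀ s, HasSum (fun k => c k * s ^ k / (k.factorial : ℂ)) (f s)) :
      HasFPowerSeriesAt f (FormalMultilinearSeries.ofScalars ℂ fun k => c k / k.factorial) 0 := by
    rw [hasFPowerSeriesAt_iff]
    refine Filter.Eventually.of_forall fun s => ?_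
    rw [zero_add]
    refine (hc s).congr_fun fun k => ?_
    rw [FormalMultilinearSeries.coeff_ofScalars, smul_eq_mul]
    ring
  have h := (key hc).eq_formalMultilinearSeries (key hd)
  funext k
  have hk := congrArg (fun p => p.coeff k) h
  simp only [FormalMultilinearSeries.coeff_ofScalars] at hk
  exact (div_left_inj' (by exact_mod_cast k.factorial_ne_zero)).mp hk

lemma eq_of_aevalAeval_eq {p q : ℤ[X][X]}
    (h : ∀ r t : ℂ, aevalAeval t r p = aevalAeval t r q) : p = q := by
  have key (t r : ℂ) (p : ℤ[X][X]) :
      aevalAeval t r p = eval r (p.map (aeval t : ℤ[X] →ₐ[ℤ] ℂ).toRingHom) := by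
    induction p using Polynomial.induction_on' with
    | add p q hp hq => rw [map_add, hp, hq, Polynomial.map_add, eval_add]
    | monomial n a =>
      rw [← C_mul_X_pow_eq_monomial, map_mul, map_pow, aevalAeval_C, aevalAeval_Y,
        Polynomial.map_mul, map_C, Polynomial.map_pow, map_X, eval_mul, eval_C, eval_pow, eval_X]
      rfl
  ext1 n
  refine Polynomial.map_injective (Int.castRingHom ℂ) Int.cast_injective
    (Polynomial.funext fun t => ?_)
  have h₁ : p.map (aeval t : ℤ[X] →ₐ[ℤ] ℂ).toRingHom = q.map (aeval t : ℤ[X] →ₐ[ℤ] ℂ).toRingHom :=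
    Polynomial.funext fun r => by rw [← key, ← key, h]
  have h₂ := congrArg (fun p => p.coeff n) h₁
  simpa [aeval_def, Polynomial.eval_map, algebraMap_int_eq] using h₂

/-- Every `r² - rt` has a complex square root, so uniqueness of power series in `s` determines the
values of `a_k` on all of `ℂ²`. -/
lemma IsExpCosExpansion.eq {a b : ℕ → ℤ[X][X]} (ha : IsExpCosExpansion a)
    (hb : IsExpCosExpansion b) : a = b := by
  funext k
  refine eq_of_aevalAeval_eq fun r t => ?_
  obtain ⟨τ, hτ⟩ := IsAlgClosed.exists_pow_nat_eq (r ^ 2 - r * t) (n := 2) (by norm_num)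
  exact congrFun (coeff_eq_of_hasSum (fun s => ha r t τ s hτ) (fun s => hb r t τ s hτ)) k

/-- The recurrence carries an overall factor `r`, so the `r`-adic order rises by at least one every
two steps. -/
lemma coeff_expCosCoeff_eq_zero {k n : ℕ} (h : 2 * n < k) : (expCosCoeff k).coeff n = 0 := by
  induction n using Nat.strong_induction_on generalizing k with
  | _ n ih =>
    match k, n with
    | 0, _ => omega
    | 1, 0 => simp [expCosCoeff]
    | 1, n + 1 => omega
    | k + 2, 0 => simp [expCosCoeff]
    | k + 2, n + 1 =>
      have h₁ := ih n (by omega) (k := k) (by omega)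
      have h₂ := ih n (by omega) (k := k + 1) (by omega)
      have h₃ : (X * expCosCoeff k).coeff n = 0 := by
        cases n with
        | zero => simp
        | succ n => rw [coeff_X_mul, ih n (by omega) (by omega)]
      rw [expCosCoeff, coeff_X_mul, coeff_add, coeff_sub, coeff_C_mul, coeff_ofNat_mul,
        coeff_ofNat_mul, h₁, h₂, h₃]
      simp

/-- The coefficients of the formal sum of the polynomials `a_k`. -/
noncomputable def gammaPoly (n : ℕ) : ℤ[X] :=
  ∑ k ∈ Finset.range (2 * n + 1), (expCosCoeff k).coeff n

lemma gammaPoly_eq {n N : ℕ} (h : 2 * n < N) :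
    gammaPoly n = (∑ k ∈ Finset.range N, expCosCoeff k).coeff n := by
  rw [finsetSum_coeff]
  refine Finset.sum_subset (Finset.range_mono h) fun k _ hk => coeff_expCosCoeff_eq_zero ?_
  simpa using hk

lemma isFormalSum_expCosCoeff_iff (A : ℕ → ℤ[X]) :
    IsFormalSum expCosCoeff A ↔ A = gammaPoly := by
  have hs (n : ℕ) : (Function.support fun k => (expCosCoeff k).coeff n) ⊆
      (Finset.range (2 * n + 1) : Set ℕ) := fun k hk => by
    by_contra h
    exact hk (coeff_expCosCoeff_eq_zero (by simpa using h))
  have he (n : ℕ) : ∑ᶠ k, (expCosCoeff k).coeff n = gammaPoly n :=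
    finsum_eq_sum_of_support_subset _ (hs n)
  simp only [IsFormalSum, he, funext_iff]
  exact forall_congr' fun n => and_iff_right ((Finset.finite_toSet _).subset (hs n))

lemma isGammaPolynomials_iff_eq (A : ℕ → ℤ[X]) : IsGammaPolynomials A ↔ A = gammaPoly := by
  rw [← isFormalSum_expCosCoeff_iff]
  constructor
  · rintro ⟨a, ha, hA⟩
    rwa [ha.eq isExpCosExpansion_expCosCoeff] at hA
  · exact fun h => ⟨_, isExpCosExpansion_expCosCoeff, h⟩

/-- The factor is `1 - 2r + (2r² - rt)`, the characteristic polynomial of the recurrence at `1`, so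
the sum telescopes to boundary terms. -/
lemma sum_expCosCoeff_mul (N : ℕ) : (∑ k ∈ Finset.range N, expCosCoeff k) *
    (1 - C (2 + X) * X + 2 * X ^ 2) =
      1 - X - expCosCoeff N - expCosCoeff (N + 1) + X * (2 * expCosCoeff N) := by
  induction N with
  | zero =>
    simp only [Finset.range_zero, Finset.sum_empty, expCosCoeff]
    ring
  | succ N ih =>
    rw [Finset.sum_range_succ, add_mul, ih, expCosCoeff, map_add, C_ofNat]
    ring

lemma mk_gammaPoly_mul : PowerSeries.mk gammaPoly *
    (1 - PowerSeries.C (2 + X) * PowerSeries.X + 2 * PowerSeries.X ^ 2) =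
      1 - PowerSeries.X := by
  have hD : (1 - PowerSeries.C (2 + X) * PowerSeries.X + 2 * PowerSeries.X ^ 2 :
      PowerSeries ℤ[X]) = ((1 - C (2 + X) * X + 2 * X ^ 2 : ℤ[X][X]) : PowerSeries ℤ[X]) := by
    have h2 : ((2 : ℤ[X][X]) : PowerSeries ℤ[X]) = 2 :=
      map_ofNat Polynomial.coeToPowerSeries.ringHom 2
    simp only [Polynomial.coe_add, Polynomial.coe_sub, Polynomial.coe_mul, Polynomial.coe_pow,
      Polynomial.coe_one, Polynomial.coe_C, Polynomial.coe_X, h2]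
  have hX : (1 - PowerSeries.X : PowerSeries ℤ[X]) = ((1 - X : ℤ[X][X]) : PowerSeries ℤ[X]) := by
    rw [Polynomial.coe_sub, Polynomial.coe_one, Polynomial.coe_X]
  ext1 n
  -- The coefficient of `r^n` sees only the first `2n + 1` of the `a_k`; the boundary terms then
  -- have no `r^n` term.
  have h : PowerSeries.coeff n (PowerSeries.mk gammaPoly *
      (1 - PowerSeries.C (2 + X) * PowerSeries.X + 2 * PowerSeries.X ^ 2)) =
      ((∑ k ∈ Finset.range (2 * n + 1), expCosCoeff k) *
        (1 - C (2 + X) * X + 2 * X ^ 2)).coeff n := by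
    rw [hD, PowerSeries.coeff_mul, Polynomial.coeff_mul]
    refine Finset.sum_congr rfl fun i hi => ?_
    rw [PowerSeries.coeff_mk, Polynomial.coeff_coe, gammaPoly_eq]
    have := Finset.HasAntidiagonal.mem_antidiagonal.mp hi
    omega
  have hlast : (X * (2 * expCosCoeff (2 * n + 1))).coeff n = 0 := by
    cases n with
    | zero => simp
    | succ n =>
      rw [coeff_X_mul, coeff_ofNat_mul, coeff_expCosCoeff_eq_zero (by omega), mul_zero]
  rw [h, sum_expCosCoeff_mul, hX, Polynomial.coeff_coe, coeff_add, hlast, coeff_sub, coeff_sub,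
    coeff_expCosCoeff_eq_zero (by omega), coeff_expCosCoeff_eq_zero (by omega)]
  simp

/-- Conversely, the denominator has constant term `1`, so it is nonzero and can be cancelled. -/
lemma isGammaPolynomials_iff_mk_mul (A : ℕ → ℤ[X]) : IsGammaPolynomials A ↔
    PowerSeries.mk A * (1 - PowerSeries.C (2 + X) * PowerSeries.X + 2 * PowerSeries.X ^ 2) =
      1 - PowerSeries.X := by
  rw [isGammaPolynomials_iff_eq]
  refine ⟨by rintro rfl; exact mk_gammaPoly_mul, fun h => ?_⟩
  rw [← mk_gammaPoly_mul] at h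
  have hD : (1 - PowerSeries.C (2 + X) * PowerSeries.X + 2 * PowerSeries.X ^ 2 :
      PowerSeries ℤ[X]) ≠ 0 := fun h0 => by
    have := congrArg PowerSeries.constantCoeff h0
    simp at this
  funext n
  simpa using congrArg (PowerSeries.coeff n) (mul_right_cancel₀ hD h)

lemma IsGammaPolynomials.recurrence {A : ℕ → ℤ[X]} (h : IsGammaPolynomials A) :
    A 0 = 1 ∧ A 1 = 1 + X ∧ ∀ n, A (n + 2) = (2 + X) * A (n + 1) - 2 * A n := by
  rw [isGammaPolynomials_iff_mk_mul] at h
  have h' : PowerSeries.mk A - PowerSeries.C (2 + X) * PowerSeries.mk A * PowerSeries.X +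
      PowerSeries.C 2 * PowerSeries.mk A * PowerSeries.X * PowerSeries.X = 1 - PowerSeries.X := by
    rw [← h, map_ofNat]
    ring
  have h₀ := congrArg (PowerSeries.coeff 0) h'
  have h₁ := congrArg (PowerSeries.coeff (0 + 1)) h'
  have hA₀ : A 0 = 1 := by simpa using h₀
  have hA₁ : A 1 = 1 + X := by
    simp only [map_sub, map_add (PowerSeries.coeff (0 + 1)), PowerSeries.coeff_succ_mul_X,
      PowerSeries.coeff_zero_mul_X, PowerSeries.coeff_C_mul, PowerSeries.coeff_mk, hA₀,
      PowerSeries.coeff_one, PowerSeries.coeff_X] at h₁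
    norm_num at h₁
    linear_combination h₁
  refine ⟨hA₀, hA₁, fun n => ?_⟩
  have h₂ := congrArg (PowerSeries.coeff (n + 1 + 1)) h'
  simp only [map_sub, map_add (PowerSeries.coeff (n + 1 + 1)), PowerSeries.coeff_succ_mul_X,
    PowerSeries.coeff_C_mul, PowerSeries.coeff_mk, PowerSeries.coeff_one, PowerSeries.coeff_X] at h₂
  norm_num at h₂
  linear_combination h₂

end Expansion

/-! ### The classes of the graphs `Γ_n` -/

section GammaClass

variable (K : Type u) [Field K]

/-- The sequences governing the recursion for the classes of the graphs `Γ_n`. -/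
noncomputable def recursionPair : ℕ → GrothendieckRing K × GrothendieckRing K
  | 0 => (0, 1)
  | n + 1 => ((torusClass K + 1) * (recursionPair n).1 + (recursionPair n).2,
      (torusClass K - 1) * (recursionPair n).1 + (recursionPair n).2)

/-- Cayley–Hamilton for the matrix of `recursionPair`, of trace `𝕋 + 2` and determinant `2`: any
linear form in the pair satisfies the recurrence of `A_n(𝕋)`. -/
lemma IsGammaPolynomials.aeval_torusClass {A : ℕ → ℤ[X]} (h : IsGammaPolynomials A) (n : ℕ) :
    Polynomial.aeval (torusClass K) (A n) =
      torusClass K * (recursionPair K n).1 + (recursionPair K n).2 := by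
  obtain ⟨h₀, h₁, h₂⟩ := h.recurrence
  induction n using Nat.twoStepInduction with
  | zero => simp [h₀, recursionPair]
  | one =>
    rw [h₁]
    simp only [map_add, map_one, Polynomial.aeval_X, recursionPair]
    ring
  | more n ih₁ ih₂ =>
    rw [h₂]
    simp only [map_sub, map_mul, map_add, map_ofNat, Polynomial.aeval_X, ih₁, ih₂, recursionPair]
    ring

lemma IsGammaPolynomials.grothendieckClass_gamma {A : ℕ → ℤ[X]} (h : IsGammaPolynomials A)
    (c : ℕ → Fin 3) (n : ℕ) : (Gamma c n).grothendieckClass K =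
      torusClass K ^ n * (torusClass K + 1) ^ (2 * n + 1) *
        Polynomial.aeval (torusClass K) (A n) := by
  obtain ⟨h₁, h₂⟩ := locusClass_coeff_markedGamma K c (fun n => (recursionPair K n).1)
    (fun n => (recursionPair K n).2) rfl rfl (fun _ => rfl) (fun _ => rfl) n
  rw [Gamma, Multigraph.grothendieckClass_eq _ (markedGamma c n).2, h₁, h₂,
    h.aeval_torusClass K]
  ring

end GammaClass

end Melonic

theorem mainTheorem5 :
    (∃! a : ℕ → Polynomial (Polynomial ℤ), Melonic.IsExpCosExpansion a) ∧
    (∃! A : ℕ → Polynomial ℤ, Melonic.IsGammaPolynomials A) ∧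
    (∀ A : ℕ → Polynomial ℤ, Melonic.IsGammaPolynomials A ↔
      PowerSeries.mk A * (1 - PowerSeries.C (2 + Polynomial.X) * PowerSeries.X
        + 2 * PowerSeries.X ^ 2) = 1 - PowerSeries.X) ∧
    (∀ A : ℕ → Polynomial ℤ, Melonic.IsGammaPolynomials A →
      ∀ (K : Type*) [Field K] (c : ℕ → Fin 3) (n : ℕ), 1 ≤ n →
        (Melonic.Gamma c n).grothendieckClass K =
          Melonic.torusClass K ^ n * (Melonic.torusClass K + 1) ^ (2 * n + 1) *
            Polynomial.aeval (Melonic.torusClass K) (A n)) := by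
  refine ⟨⟨Melonic.expCosCoeff, Melonic.isExpCosExpansion_expCosCoeff,
      fun a ha => ha.eq Melonic.isExpCosExpansion_expCosCoeff⟩,
    ⟨Melonic.gammaPoly, (Melonic.isGammaPolynomials_iff_eq _).mpr rfl,
      fun A hA => (Melonic.isGammaPolynomials_iff_eq A).mp hA⟩,
    Melonic.isGammaPolynomials_iff_mk_mul, fun A hA K _ c n _ => ?_⟩
  exact hA.grothendieckClass_gamma K c n
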